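/- Let the polynomials $c_m=c_m(c_1)\in\mathbb{Q}[c_1]$, $m\geqslant 0$, be defined by $c_0=1$, $c_1(c_1)=c_1$, and, for $m\geqslant 2$, $$ (m^2-1)\,c_m=\sum_{p=0}^{m-2}(p+2)\bigl(m-2(p+1)\bigr)c_{p+1}c_{m-p-1}+4\sum_{p=0}^{m-2}\sum_{p_1=0}^{p}c_{m-p-2}\,c_{p_1}c_{p-p_1} $$ (equivalently, $y(x)=-\frac{x}{2}\bigl(1+\sum_{m\geqslant1}c_mx^m\bigr)$ is a formal solution of the degenerate third Painlevé equation $y''=\frac{(y')^2}{y}-\frac{y'}{x}-\frac1x\bigl(8y^2+\frac12\bigr)-\frac1{4y}$). Put $d_m=\lfloor m/3\rfloor+1$ if $m\equiv1\pmod 3$ and $d_m=\lfloor m/3\rfloor$ otherwise, and let $p_{m,n}$ be the coefficient of $c_1^{\,d_m-2n}$ in $c_m(c_1)$ for $0\leqslant 2n\leqslant d_m$. Then the following hold. (i) $p_{4,1}=\frac{16}{15}$, $p_{7,1}=\frac{1336}{945}$, and, for $k=3,4,\ldots$, $$p_{3k+1,1}=\frac{2}{5^{6}}\left(2916k^{2}+\frac{328779}{49}k-\frac{34129}{147}\right)(k+1)^{2}\left(\frac29\right)^{k}.$$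 (ii) $p_{6,1}=\frac{256}{315}$, $p_{9,1}=\frac{253774}{212625}$, $p_{12,1}=\frac{4788251008}{4862521125}$, and, for $k=5,6,\ldots$, $$p_{3k,1}=\frac{1}{5^{7}}\left(\frac{8748}{5}k^{3}+\frac{223074}{49}k^{2}-\frac{281982223}{48020}k-\frac{15481989}{41503}\right)(3k+2)^{2}\left(\frac29\right)^{k}.$$ (iii) $p_{8,1}=\frac{4864}{8505}$, $p_{11,1}=\frac{3958936}{4209975}$, $p_{14,1}=\frac{44744664088576}{51771262417875}$, and, for $k=5,6,\ldots$, $$p_{3k+2,1}=\frac{3}{5^{10}}\left(\frac{34992}{5}k^{4}+\frac{10865016}{245}k^{3}+\frac{86107493}{12005}k^{2}-\frac{86860273454}{1452605}k+\frac{8029312488}{7014007}\right)(3k+4)^{2}\left(\frac29\right)^{k}.$$ (iv) The generating functions $A_3(z)=\sum_{k\geqslant1}p_{3k+1,1}z^{3k+1}$, $A_4(z)=\sum_{k\geqslant2}p_{3k,1}z^{3k}$ and $A_5(z)=\sum_{k\geqslant2}p_{3k+2,1}z^{3k+2}$ are the expansions at $z=0$ of the following rational functions, where $D=(1-2z^3/9)^{-1}$: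 $$A_3=-\frac{32}{2953125}z^{7}-\frac{8752}{4134375}z^{4}+\frac{68258}{2296875}z+\frac{116878}{459375}zD^{2}+\frac{8086604}{2296875}zD^{3}-\frac{9771516}{765625}zD^{4}+\frac{139968}{15625}zD^{5},$$ $$\begin{aligned}A_4&=\frac{256}{13953515625}z^{12}-\frac{78928}{45581484375}z^{9}-\frac{17694848}{1838453203125}z^{6}-\frac{330698309}{81709031250}z^{3}+\frac{61927956}{3242421875}+\frac{48238574611}{453939062500}D\\&\quad-\frac{1400615705869}{453939062500}D^{2}+\frac{1407265401}{2316015625}D^{3}+\frac{59441369643}{1875781250}D^{4}-\frac{1024460784}{19140625}D^{5}+\frac{1889568}{78125}D^{6},\end{aligned}$$ $$\begin{aligned}A_5&=\frac{131072}{197791083984375}z^{14}+\frac{90116032}{564070869140625}z^{11}-\frac{324630499328}{23302394349609375}z^{8}+\frac{4366976622}{9785166015625}z^{5}-\frac{385406999424}{68496162109375}z^{2}\\&\quad+\frac{4531503785253}{479473134765625}z^{2}D+\frac{59545228803909}{479473134765625}z^{2}D^{2}-\frac{37276082380518}{13699232421875}z^{2}D^{3}+\frac{14383449268992}{2837119140625}z^{2}D^{4}\\&\quad+\frac{268395996744}{23447265625}z^{2}D^{5}-\frac{13329012672}{478515625}z^{2}D^{6}+\frac{136048896}{9765625}z^{2}D^{7}.\end{aligned}$$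 -/

import Mathlib

namespace DegeneratePIII

open Polynomial

/-- The polynomials `c_m(c₁)` over `ℚ` (the variable `X` is the parameter `c₁`): `c_0 = 1`,
`c_1 = X`, and, for `m ≥ 2`, `c_m` is given by the recurrence relation for the coefficients of the
expansion `y(x) = -(x/2) (1 + ∑_{m ≥ 1} c_m x^m)`. The form of the recurrence with its usual
indices is `c_recurrence` below. -/
noncomputable def c : ℕ → ℚ[X]
  | 0 => 1
  | 1 => X
  | m + 2 =>
    C (1 / (((m : ℚ) + 2) ^ 2 - 1)) *
      ((∑ p : Fin (m + 1),
          C (((p : ℚ) + 2) * (((m : ℚ) + 2) - 2 * ((p : ℚ) + 1))) * c (p + 1) * c (m + 1 - p)) +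
        4 * ∑ p : Fin (m + 1), ∑ q : Fin ((p : ℕ) + 1), c (m - p) * c q * c (p - q))
termination_by m => m
decreasing_by all_goals omega

/-- The recurrence relation that determines `c`, for all `m ≥ 2`. -/
theorem c_recurrence (m : ℕ) (hm : 2 ≤ m) :
    C ((m : ℚ) ^ 2 - 1) * c m =
      ∑ p ∈ Finset.range (m - 1),
          C (((p : ℚ) + 2) * ((m : ℚ) - 2 * ((p : ℚ) + 1))) * c (p + 1) * c (m - p - 1) +
        4 * ∑ p ∈ Finset.range (m - 1), ∑ q ∈ Finset.range (p + 1),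
          c (m - p - 2) * c q * c (p - q) := by
  obtain ⟨n, rfl⟩ : ∃ n, m = n + 2 := ⟨m - 2, by omega⟩
  have h : (((n : ℚ) + 2) ^ 2 - 1) ≠ 0 := by
    have : (0 : ℚ) ≤ n := Nat.cast_nonneg n
    nlinarith
  have e : n + 2 - 1 = n + 1 := by omega
  have e1 : ∀ p, n + 2 - p - 1 = n + 1 - p := by intro p; omega
  have e2 : ∀ p, n + 2 - p - 2 = n - p := by intro p; omega
  rw [c]
  push_cast
  simp only [e1, e2]
  rw [← mul_assoc, ← C_mul, mul_one_div_cancel h, C_1, one_mul, Finset.sum_range, Finset.sum_range]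
  simp only [Finset.sum_range]

/-- The top exponent `[m/3] + δ` in `c_m`, where `δ = 1` if `m = 3k + 1` and `δ = 0` otherwise. -/
def deg (m : ℕ) : ℕ := m / 3 + if m % 3 = 1 then 1 else 0

/-- The coefficients `p_{m,n}` in `c_m = ∑_n p_{m,n} c₁ ^ ([m/3] + δ - 2n)`, where
`0 ≤ 2n ≤ [m/3] + δ`; there is no such coefficient, and `p m n = 0`, for larger `n`. -/
noncomputable def p (m n : ℕ) : ℚ := if 2 * n ≤ deg m then (c m).coeff (deg m - 2 * n) else 0

/-- The power series in `z` that keeps, among the terms `p_{m,1} z^m`, those with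
`m ≡ r (mod 3)`; for `r = 1, 0, 2` these are `A₃`, `A₄`, `A₅`. -/
noncomputable def genFun (r : ℕ) : PowerSeries ℚ :=
  PowerSeries.mk fun m => if m % 3 = r then p m 1 else 0

/-- The power series expansion at `z = 0` of `1 / (1 - 2z³/9)`. -/
noncomputable def D : PowerSeries ℚ :=
  (1 - PowerSeries.C (2 / 9 : ℚ) * PowerSeries.X ^ 3)⁻¹

end DegeneratePIII

namespace DegeneratePIII

open Polynomial

/-- The Euler derivation `z d/dz` on formal power series. -/
noncomputable def euler {R : Type*} [CommRing R] (f : PowerSeries R) : PowerSeries R :=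
  PowerSeries.X * PowerSeries.derivative R f

section Euler

variable {R : Type*} [CommRing R]

theorem coeff_euler (f : PowerSeries R) (m : ℕ) :
    PowerSeries.coeff m (euler f) = m * PowerSeries.coeff m f := by
  cases m with
  | zero => simp [euler]
  | succ m =>
    rw [euler, PowerSeries.coeff_succ_X_mul, PowerSeries.coeff_derivative]
    push_cast
    ring

theorem euler_add (f g : PowerSeries R) : euler (f + g) = euler f + euler g := by
  simp [euler, mul_add]

theorem euler_sub (f g : PowerSeries R) : euler (f - g) = euler f - euler g := by
  simp [euler, mul_sub]

theorem euler_mul (f g : PowerSeries R) : euler (f * g) = f * euler g + g * euler f := by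
  simp only [euler, Derivation.leibniz, smul_eq_mul]
  ring

theorem euler_pow (f : PowerSeries R) (n : ℕ) :
    euler (f ^ (n + 1)) = (n + 1) * f ^ n * euler f := by
  induction n with
  | zero => simp
  | succ n ih =>
    rw [pow_succ f (n + 1), euler_mul, ih]
    push_cast
    ring

theorem euler_C (a : R) : euler (PowerSeries.C a) = 0 := by
  simp [euler]

theorem euler_X_pow (n : ℕ) : euler (PowerSeries.X ^ n : PowerSeries R)
    = n * (PowerSeries.X ^ n : PowerSeries R) := by
  cases n with
  | zero => simp [euler]
  | succ n =>
    rw [euler_pow, euler, PowerSeries.derivative_X]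
    push_cast
    ring

end Euler

/-- The coefficients in `z` of the solution `(U, σ)` of the regular system
`θU = U + z²U²σ - ε`, `θσ = 4 - 3σ - z²Uσ²` with `U = ε + z + ⋯`, as polynomials in `ε = X`. -/
noncomputable def regularPair : ℕ → ℚ[X] × ℚ[X]
  | 0 => (X, C (4 / 3))
  | 1 => (1, 0)
  | m + 2 =>
    (C (1 / ((m : ℚ) + 1)) * ∑ i : Fin (m + 1), ∑ j : Fin ((m - i : ℕ) + 1),
        (regularPair i).1 * ((regularPair j).1 * (regularPair (m - i - j)).2),
      C (-1 / ((m : ℚ) + 5)) * ∑ i : Fin (m + 1), ∑ j : Fin ((m - i : ℕ) + 1),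
        (regularPair i).1 * ((regularPair j).2 * (regularPair (m - i - j)).2))
termination_by m => m
decreasing_by all_goals omega

/-- The first component of the solution of the regular system. -/
noncomputable def scaledSol : PowerSeries ℚ[X] := PowerSeries.mk fun m => (regularPair m).1

/-- The second component of the solution of the regular system. -/
noncomputable def auxSol : PowerSeries ℚ[X] := PowerSeries.mk fun m => (regularPair m).2

theorem coeff_mul_mul {R : Type*} [CommRing R] (f g h : PowerSeries R) (m : ℕ) :
    PowerSeries.coeff m (f * (g * h)) = ∑ i ∈ Finset.range (m + 1),
      ∑ j ∈ Finset.range (m - i + 1), PowerSeries.coeff i f *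
        (PowerSeries.coeff j g * PowerSeries.coeff (m - i - j) h) := by
  rw [PowerSeries.coeff_mul, Finset.Nat.sum_antidiagonal_eq_sum_range_succ_mk]
  refine Finset.sum_congr rfl fun i _ => ?_
  rw [PowerSeries.coeff_mul, Finset.Nat.sum_antidiagonal_eq_sum_range_succ_mk, Finset.mul_sum]

theorem euler_scaledSol : euler scaledSol =
    scaledSol + PowerSeries.X ^ 2 * (scaledSol * (scaledSol * auxSol)) - PowerSeries.C X := by
  ext1 m
  rw [coeff_euler, map_sub, map_add]
  match m with
  | 0 => simp [scaledSol, regularPair, PowerSeries.coeff_X_pow_mul']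
  | 1 => simp [scaledSol, regularPair, PowerSeries.coeff_X_pow_mul']
  | m + 2 =>
    have h : ((m : ℚ) + 1) ≠ 0 := by positivity
    rw [PowerSeries.coeff_X_pow_mul, coeff_mul_mul, PowerSeries.coeff_C, if_neg (by omega)]
    simp only [scaledSol, auxSol, PowerSeries.coeff_mk]
    rw [regularPair, Finset.sum_range]
    simp only [Finset.sum_range]
    have e : ((m + 2 : ℕ) : ℚ[X]) = C ((m : ℚ) + 1) + 1 := by
      simp
      ring
    rw [e, add_mul, ← mul_assoc, ← C_mul, mul_one_div_cancel h]
    simp only [C_1, one_mul]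
    ring

theorem euler_auxSol : euler auxSol =
    4 - 3 * auxSol - PowerSeries.X ^ 2 * (scaledSol * (auxSol * auxSol)) := by
  ext1 m
  have e4 : (4 : PowerSeries ℚ[X]) = PowerSeries.C 4 := (map_ofNat _ 4).symm
  have e3 : (3 : PowerSeries ℚ[X]) = PowerSeries.C 3 := (map_ofNat _ 3).symm
  rw [coeff_euler, map_sub, map_sub, e4, e3, PowerSeries.coeff_C_mul, PowerSeries.coeff_C]
  match m with
  | 0 =>
    have h : (4 : ℚ[X]) = 3 * C (4 / 3) := by
      rw [← map_ofNat C 4, ← map_ofNat C 3, ← C_mul]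
      norm_num
    simp [auxSol, regularPair, PowerSeries.coeff_X_pow_mul', ← h]
  | 1 => simp [auxSol, regularPair, PowerSeries.coeff_X_pow_mul']
  | m + 2 =>
    have h : ((m : ℚ) + 5) ≠ 0 := by positivity
    rw [PowerSeries.coeff_X_pow_mul, coeff_mul_mul, if_neg (by omega)]
    simp only [scaledSol, auxSol, PowerSeries.coeff_mk]
    rw [regularPair, Finset.sum_range]
    simp only [Finset.sum_range]
    have e : ((m + 2 : ℕ) : ℚ[X]) = C ((m : ℚ) + 5) - 3 := by
      rw [C_add, map_ofNat]
      simp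
      ring
    rw [e, sub_mul, ← mul_assoc, ← C_mul, mul_div_cancel₀ _ h]
    simp only [map_neg, C_1]
    ring

/-- The scaled form of the degenerate third Painlevé equation. -/
theorem scaledSol_eq :
    scaledSol * euler (euler scaledSol) - euler scaledSol ^ 2 - PowerSeries.C X * scaledSol
      + PowerSeries.C X ^ 2 = 4 * (PowerSeries.X ^ 2 * scaledSol ^ 3) := by
  have h := congrArg euler euler_scaledSol
  rw [euler_sub, euler_add, euler_mul, euler_mul scaledSol, euler_mul scaledSol, euler_X_pow,
    euler_auxSol, euler_C] at h
  rw [h, euler_scaledSol]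
  push_cast
  ring

theorem sum_antisymm_eq_zero {A : Type*} [CommRing A] [IsDomain A] [CharZero A] (f : ℕ → A)
    (n : ℕ) :
    ∑ i ∈ Finset.range (n + 1), (((n - i : ℕ) : A) - i) * f (i + 1) * f (n - i + 1) = 0 := by
  set S := ∑ i ∈ Finset.range (n + 1), (((n - i : ℕ) : A) - i) * f (i + 1) * f (n - i + 1)
    with hS
  have h : S = -S := by
    conv_lhs => rw [hS, ← Finset.sum_range_reflect]
    rw [hS, ← Finset.sum_neg_distrib]
    refine Finset.sum_congr rfl fun i hi => ?_
    have hi' : i ≤ n := by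
      have := Finset.mem_range.1 hi
      omega
    rw [show n + 1 - 1 - i = n - i by omega, show n - (n - i) = i by omega]
    ring
  exact self_eq_neg.1 h

/-- A power series that satisfies the degenerate third Painlevé equation, written for
`v = -2y/x`, obeys the recurrence relation of the polynomials `c`. -/
theorem recurrence_of_painleve {A : Type*} [CommRing A] [IsDomain A] [CharZero A]
    (v : PowerSeries A) (h0 : PowerSeries.coeff 0 v = 1)
    (h : v * euler (euler v) - euler v ^ 2 - v + 1 = 4 * (PowerSeries.X ^ 2 * v ^ 3)) (n : ℕ) :
    (((n : A) + 2) ^ 2 - 1) * PowerSeries.coeff (n + 2) v =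
      ∑ i ∈ Finset.range (n + 1), (((i : A) + 2) * (((n : A) + 2) - 2 * ((i : A) + 1))) *
          PowerSeries.coeff (i + 1) v * PowerSeries.coeff (n - i + 1) v +
        4 * ∑ i ∈ Finset.range (n + 1), ∑ j ∈ Finset.range (i + 1),
          PowerSeries.coeff (n - i) v * PowerSeries.coeff j v * PowerSeries.coeff (i - j) v := by
  have hc := congrArg (PowerSeries.coeff (n + 2)) h
  rw [show (4 : PowerSeries A) = PowerSeries.C 4 from (map_ofNat _ 4).symm,
    PowerSeries.coeff_C_mul, PowerSeries.coeff_X_pow_mul, map_add, map_sub, map_sub,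
    PowerSeries.coeff_one, if_neg (by omega), pow_two, PowerSeries.coeff_mul,
    PowerSeries.coeff_mul, Finset.Nat.sum_antidiagonal_eq_sum_range_succ_mk,
    Finset.Nat.sum_antidiagonal_eq_sum_range_succ_mk, ← Finset.sum_sub_distrib,
    Finset.sum_range_succ, Finset.sum_range_succ', show v ^ 3 = (v * v) * v by ring,
    PowerSeries.coeff_mul, Finset.Nat.sum_antidiagonal_eq_sum_range_succ_mk] at hc
  simp only [coeff_euler] at hc
  have hcube : ∑ i ∈ Finset.range n.succ, PowerSeries.coeff i (v * v) * PowerSeries.coeff (n - i) v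
      = ∑ i ∈ Finset.range (n + 1), ∑ j ∈ Finset.range (i + 1),
          PowerSeries.coeff (n - i) v * PowerSeries.coeff j v * PowerSeries.coeff (i - j) v := by
    refine Finset.sum_congr rfl fun i _ => ?_
    rw [PowerSeries.coeff_mul, Finset.Nat.sum_antidiagonal_eq_sum_range_succ_mk, Finset.sum_mul]
    exact Finset.sum_congr rfl fun j _ => by ring
  rw [← hcube]
  have hs := sum_antisymm_eq_zero (fun i => PowerSeries.coeff i v) n
  have hq : ∑ i ∈ Finset.range (n + 1), (((i : A) + 2) * (((n : A) + 2) - 2 * ((i : A) + 1))) *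
          PowerSeries.coeff (i + 1) v * PowerSeries.coeff (n - i + 1) v
      = -∑ i ∈ Finset.range (n + 1), (PowerSeries.coeff (i + 1) v *
          (((n + 2 - (i + 1) : ℕ) : A) * (((n + 2 - (i + 1) : ℕ) : A) *
            PowerSeries.coeff (n + 2 - (i + 1)) v)) -
          ((i + 1 : ℕ) : A) * PowerSeries.coeff (i + 1) v *
            (((n + 2 - (i + 1) : ℕ) : A) * PowerSeries.coeff (n + 2 - (i + 1)) v)) := by
    rw [← add_eq_zero_iff_eq_neg, ← Finset.sum_add_distrib, ← mul_zero ((n : A) + 3), ← hs,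
      Finset.mul_sum]
    refine Finset.sum_congr rfl fun i hi => ?_
    obtain ⟨k, rfl⟩ : ∃ k, n = i + k := ⟨n - i, by have := Finset.mem_range.1 hi; omega⟩
    rw [show i + k + 2 - (i + 1) = k + 1 by omega, show i + k - i = k by omega]
    push_cast
    ring
  rw [hq]
  simp only [Nat.sub_self, Nat.sub_zero, h0] at hc
  push_cast at hc ⊢
  linear_combination hc

/-- The polynomials `c` evaluated at an element of a `ℚ`-algebra are the coefficients of the
corresponding power series solution. -/
theorem coeff_eq_aeval_c {A : Type*} [CommRing A] [IsDomain A] [Algebra ℚ A]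
    (v : PowerSeries A) (h0 : PowerSeries.coeff 0 v = 1)
    (h : v * euler (euler v) - euler v ^ 2 - v + 1 = 4 * (PowerSeries.X ^ 2 * v ^ 3)) (m : ℕ) :
    PowerSeries.coeff m v = aeval (PowerSeries.coeff 1 v) (c m) := by
  have : CharZero A := algebraRat.charZero A
  induction m using Nat.strong_induction_on with
  | _ m ih =>
    match m, ih with
    | 0, _ => simp [c, h0]
    | 1, _ => simp [c]
    | n + 2, ih =>
      have hr := congrArg (aeval (PowerSeries.coeff 1 v)) (c_recurrence (n + 2) (by omega))
      have hv := recurrence_of_painleve v h0 h n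
      have hne : (((n : A) + 2) ^ 2 - 1) ≠ 0 := by
        have : (((n + 2) ^ 2 - 1 : ℕ) : A) ≠ 0 := by
          rw [Nat.cast_ne_zero]
          have : 1 < (n + 2) ^ 2 := Nat.one_lt_pow two_ne_zero (by omega)
          omega
        rwa [Nat.cast_sub (Nat.one_le_pow _ _ (by omega)), Nat.cast_pow, Nat.cast_add, Nat.cast_one,
          Nat.cast_ofNat] at this
      apply mul_left_cancel₀ hne
      rw [hv]
      simp only [map_mul, map_add, map_sum, map_ofNat, map_sub, map_pow, map_natCast,
        map_one, Nat.cast_add, Nat.cast_ofNat] at hr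
      rw [hr]
      congr 1
      · refine Finset.sum_congr (by congr 1) fun i hi => ?_
        have hi' : i < n + 1 := Finset.mem_range.1 hi
        rw [ih (i + 1) (by omega), ih (n - i + 1) (by omega),
          show n + 2 - i - 1 = n - i + 1 by omega]
      · congr 1
        refine Finset.sum_congr (by congr 1) fun i hi => Finset.sum_congr rfl fun j hj => ?_
        have hi' : i < n + 1 := Finset.mem_range.1 hi
        have hj' : j < i + 1 := Finset.mem_range.1 hj
        rw [ih (n - i) (by omega), ih j (by omega), ih (i - j) (by omega),
          show n + 2 - i - 2 = n - i by omega]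

theorem euler_map {A B : Type*} [CommRing A] [CommRing B] (φ : A →+* B) (f : PowerSeries A) :
    euler (PowerSeries.map φ f) = PowerSeries.map φ (euler f) := by
  ext m
  simp [coeff_euler]

theorem euler_rescale {A : Type*} [CommRing A] (a : A) (f : PowerSeries A) :
    euler (PowerSeries.rescale a f) = PowerSeries.rescale a (euler f) := by
  ext m
  simp only [coeff_euler, PowerSeries.coeff_rescale]
  ring

open LaurentPolynomial in
/-- The scaling that relates the polynomials `c` to the solution of the regular system. -/
theorem aeval_c_eq (m : ℕ) :
    aeval (T (-3) : LaurentPolynomial ℚ) (c m) =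
      T (-m - 2) * aeval (T 2 : LaurentPolynomial ℚ) (PowerSeries.coeff m scaledSol) := by
  set ι : ℚ[X] →+* LaurentPolynomial ℚ := (aeval (T 2 : LaurentPolynomial ℚ)).toRingHom with hι
  set w : PowerSeries (LaurentPolynomial ℚ) :=
    PowerSeries.rescale (T (-1)) (PowerSeries.map ι scaledSol) with hw
  set v : PowerSeries (LaurentPolynomial ℚ) := PowerSeries.C (T (-1)) ^ 2 * w with hv
  have hcoeff : ∀ m : ℕ, PowerSeries.coeff m v =
      T (-m - 2) * aeval (T 2 : LaurentPolynomial ℚ) (PowerSeries.coeff m scaledSol) := by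
    intro m
    rw [hv, hw, ← map_pow, PowerSeries.coeff_C_mul, PowerSeries.coeff_rescale,
      PowerSeries.coeff_map, T_pow, T_pow, ← mul_assoc, ← T_add]
    congr 2
    push_cast
    ring
  have hE := congrArg (fun f => PowerSeries.rescale (T (-1)) (PowerSeries.map ι f)) scaledSol_eq
  simp only [map_add, map_sub, map_mul, map_pow, map_ofNat, ← euler_map, ← euler_rescale,
    PowerSeries.map_C, PowerSeries.map_X, PowerSeries.rescale_X, ← hw] at hE
  have hC : PowerSeries.rescale (T (-1)) (PowerSeries.C (ι X)) =
      PowerSeries.C (T 2 : LaurentPolynomial ℚ) := by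
    ext1 n
    rw [PowerSeries.coeff_rescale, PowerSeries.coeff_C, PowerSeries.coeff_C]
    split_ifs with h
    · simp [h, hι]
    · simp
  rw [hC] at hE
  have hτ : PowerSeries.C (T (-1) : LaurentPolynomial ℚ) ^ 2 *
      PowerSeries.C (T 2 : LaurentPolynomial ℚ) = 1 := by
    rw [← map_pow, ← map_mul, T_pow, ← T_add]
    simp
  have hev : euler v = PowerSeries.C (T (-1)) ^ 2 * euler w := by
    rw [hv, euler_mul, ← map_pow, euler_C]
    ring
  have heev : euler (euler v) = PowerSeries.C (T (-1)) ^ 2 * euler (euler w) := by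
    rw [hev, euler_mul, ← map_pow, euler_C]
    ring
  have h0 : PowerSeries.coeff 0 v = 1 := by
    rw [hcoeff, scaledSol, PowerSeries.coeff_mk, regularPair, aeval_X, ← T_add]
    simp
  have h1 : PowerSeries.coeff 1 v = T (-3) := by
    rw [hcoeff]
    simp [scaledSol, regularPair]
  have hP : v * euler (euler v) - euler v ^ 2 - v + 1 = 4 * (PowerSeries.X ^ 2 * v ^ 3) := by
    rw [heev, hev, hv]
    linear_combination PowerSeries.C (T (-1)) ^ 4 * hE
      + (PowerSeries.C (T (-1)) ^ 2 * w
        - (PowerSeries.C (T (-1)) ^ 2 * PowerSeries.C (T 2) + 1)) * hτ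
  rw [← hcoeff, coeff_eq_aeval_c v h0 hP m, h1]

section LaurentCoefficients

open LaurentPolynomial

theorem T_mul_aeval_monomial (a b : ℤ) (n : ℕ) (r : ℚ) :
    T b * aeval (T a : LaurentPolynomial ℚ) (monomial n r)
      = AddMonoidAlgebra.single (a * n + b) r := by
  rw [aeval_monomial, T_pow, single_eq_C_mul_T, ← LaurentPolynomial.C_eq_algebraMap, T_add,
    mul_comm a]
  ring

theorem coeff_T_mul_aeval (f : ℚ[X]) {a : ℤ} (b : ℤ) (ha : a ≠ 0) (i : ℕ) :
    (T b * aeval (T a : LaurentPolynomial ℚ) f).coeff (a * i + b) = f.coeff i := by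
  induction f using Polynomial.induction_on' with
  | add p q hp hq =>
    rw [map_add (aeval _), mul_add, AddMonoidAlgebra.coeff_add, Finsupp.add_apply, hp, hq,
      coeff_add]
  | monomial n r =>
    rw [T_mul_aeval_monomial, AddMonoidAlgebra.coeff_single, Finsupp.single_apply,
      coeff_monomial]
    simp [ha]

theorem coeff_T_mul_aeval_eq_zero (f : ℚ[X]) (a b e : ℤ) (he : ∀ i : ℕ, a * i + b ≠ e) :
    (T b * aeval (T a : LaurentPolynomial ℚ) f).coeff e = 0 := by
  induction f using Polynomial.induction_on' with
  | add p q hp hq =>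
    rw [map_add (aeval _), mul_add, AddMonoidAlgebra.coeff_add, Finsupp.add_apply, hp, hq, add_zero]
  | monomial n r =>
    rw [T_mul_aeval_monomial, AddMonoidAlgebra.coeff_single, Finsupp.single_apply,
      if_neg (he n)]

theorem coeff_c_eq {m i j : ℕ} (h : 3 * j + 2 * i = m + 2) :
    (c m).coeff j = (PowerSeries.coeff m scaledSol).coeff i := by
  have h1 := coeff_T_mul_aeval (c m) (a := -3) 0 (by norm_num) j
  rw [T_zero, one_mul, aeval_c_eq, show -3 * (j : ℤ) + 0 = 2 * i + (-m - 2) by omega,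
    coeff_T_mul_aeval _ _ (by norm_num)] at h1
  exact h1.symm

theorem coeff_scaledSol_eq_zero {m i : ℕ} (h : ∀ j : ℕ, 3 * j + 2 * i ≠ m + 2) :
    (PowerSeries.coeff m scaledSol).coeff i = 0 := by
  have h1 := coeff_T_mul_aeval (PowerSeries.coeff m scaledSol) (a := 2) (-m - 2) (by norm_num) i
  rw [← aeval_c_eq, ← one_mul (aeval _ _), ← T_zero, coeff_T_mul_aeval_eq_zero] at h1
  · exact h1.symm
  · intro j hj
    exact h j (by omega)

end LaurentCoefficients

/-- The part of order `i` in the parameter `X` of a power series with polynomial coefficients. -/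
noncomputable def level (i : ℕ) (f : PowerSeries ℚ[X]) : PowerSeries ℚ :=
  PowerSeries.mk fun m => (PowerSeries.coeff m f).coeff i

theorem genFun_eq_level {r i : ℕ} (h : (r = 1 ∧ i = 3) ∨ (r = 0 ∧ i = 4) ∨ (r = 2 ∧ i = 5)) :
    genFun r = level i scaledSol := by
  ext m
  simp only [genFun, level, PowerSeries.coeff_mk, p]
  have hdeg : deg m = m / 3 + if m % 3 = 1 then 1 else 0 := rfl
  by_cases hr : m % 3 = r
  · rw [if_pos hr]
    by_cases hd : 2 * 1 ≤ deg m
    · rw [if_pos hd]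
      apply coeff_c_eq
      split_ifs at hdeg <;> omega
    · rw [if_neg hd, coeff_scaledSol_eq_zero]
      intro j
      split_ifs at hdeg <;> omega
  · rw [if_neg hr, coeff_scaledSol_eq_zero]
    intro j
    omega

section Level

theorem level_add (i : ℕ) (f g : PowerSeries ℚ[X]) :
    level i (f + g) = level i f + level i g := by
  ext m
  simp [level]

theorem level_sub (i : ℕ) (f g : PowerSeries ℚ[X]) :
    level i (f - g) = level i f - level i g := by
  ext m
  simp [level]

theorem level_euler (i : ℕ) (f : PowerSeries ℚ[X]) : level i (euler f) = euler (level i f) := by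
  ext m
  simp only [level, coeff_euler, PowerSeries.coeff_mk]
  rw [← map_natCast (C (R := ℚ)), coeff_C_mul]

theorem level_mul (i : ℕ) (f g : PowerSeries ℚ[X]) :
    level i (f * g) = ∑ a ∈ Finset.HasAntidiagonal.antidiagonal i, level a.1 f * level a.2 g := by
  ext m
  simp only [level, PowerSeries.coeff_mk, PowerSeries.coeff_mul, finsetSum_coeff,
    Polynomial.coeff_mul, map_sum]
  exact Finset.sum_comm

theorem level_C_X_mul (i : ℕ) (f : PowerSeries ℚ[X]) :
    level (i + 1) (PowerSeries.C X * f) = level i f := by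
  ext m
  simp [level, coeff_X_mul]

theorem level_zero_C_X_mul (f : PowerSeries ℚ[X]) : level 0 (PowerSeries.C X * f) = 0 := by
  ext m
  simp [level]

theorem level_four_mul_X_sq_mul (i : ℕ) (f : PowerSeries ℚ[X]) :
    level i (4 * (PowerSeries.X ^ 2 * f)) = 4 * (PowerSeries.X ^ 2 * level i f) := by
  ext m
  rw [← map_ofNat (PowerSeries.C (R := ℚ[X])) 4, ← map_ofNat (PowerSeries.C (R := ℚ)) 4]
  simp only [level, PowerSeries.coeff_mk, PowerSeries.coeff_C_mul, PowerSeries.coeff_X_pow_mul']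
  rw [← map_ofNat (C (R := ℚ)) 4, coeff_C_mul]
  split_ifs <;> simp

theorem level_C_X_sq (i : ℕ) :
    level i (PowerSeries.C X ^ 2) = if i = 2 then 1 else 0 := by
  ext m
  rw [← map_pow]
  simp only [level, PowerSeries.coeff_mk, PowerSeries.coeff_C]
  split_ifs with h1 h2 h2 <;> simp [h1, h2, coeff_X_pow]

end Level

/-- The equation at order `i` for the expansion `∑ A_i ε^i` of a solution of the scaled
degenerate third Painlevé equation. -/
def LevelEq (A : ℕ → PowerSeries ℚ) (i : ℕ) : Prop :=
  ∑ a ∈ Finset.HasAntidiagonal.antidiagonal i, A a.1 * euler (euler (A a.2))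
      - ∑ a ∈ Finset.HasAntidiagonal.antidiagonal i, euler (A a.1) * euler (A a.2)
      - (if i = 0 then 0 else A (i - 1)) + (if i = 2 then 1 else 0)
    = 4 * (PowerSeries.X ^ 2 * ∑ a ∈ Finset.HasAntidiagonal.antidiagonal i,
        A a.1 * ∑ b ∈ Finset.HasAntidiagonal.antidiagonal a.2, A b.1 * A b.2)

theorem levelEq_scaledSol (i : ℕ) : LevelEq (fun j => level j scaledSol) i := by
  have h := congrArg (level i) scaledSol_eq
  rw [level_add, level_sub, level_sub, level_mul _ scaledSol (euler (euler scaledSol)),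
    pow_two (euler scaledSol), level_mul _ (euler scaledSol), level_four_mul_X_sq_mul,
    level_C_X_sq, pow_succ' scaledSol 2, pow_two scaledSol, level_mul _ scaledSol] at h
  simp only [level_mul _ scaledSol scaledSol, level_euler] at h
  unfold LevelEq
  rw [← h]
  congr 2
  cases i with
  | zero => simp [level_zero_C_X_mul]
  | succ i => simp [level_C_X_mul]

/-- The linearized equation has no solution without a term of degree one. -/
theorem eq_zero_of_linearized {S Δ T : PowerSeries ℚ} (hS0 : PowerSeries.coeff 0 S = 0)
    (hS1 : PowerSeries.coeff 1 S ≠ 0) (hΔ : PowerSeries.coeff 1 Δ = 0)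
    (h : S * euler (euler Δ) + Δ * euler (euler S) - 2 * (euler S * euler Δ)
      = PowerSeries.X ^ 2 * (T * Δ)) : Δ = 0 := by
  ext m
  rw [map_zero]
  induction m using Nat.strong_induction_on with
  | _ m ih =>
    have hvanish : ∀ F G : PowerSeries ℚ, PowerSeries.coeff 0 F = 0 →
        (∀ j < m, PowerSeries.coeff j G = 0) → PowerSeries.coeff (m + 1) (F * G)
          = PowerSeries.coeff 1 F * PowerSeries.coeff m G := by
      intro F G hF hG
      rw [PowerSeries.coeff_mul]
      refine Finset.sum_eq_single_of_mem (1, m) (by simp [add_comm]) ?_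
      rintro ⟨a, b⟩ hab hne
      rw [Finset.HasAntidiagonal.mem_antidiagonal] at hab
      simp only at hab
      rcases Nat.eq_zero_or_pos a with rfl | ha
      · simp only [hF, zero_mul]
      · rw [hG b, mul_zero]
        have : a ≠ 1 := by
          rintro rfl
          exact hne (by rw [show b = m by omega])
        omega
    have hm := congrArg (PowerSeries.coeff (m + 1)) h
    have hT : PowerSeries.coeff (m + 1) (PowerSeries.X ^ 2 * (T * Δ)) = 0 := by
      rw [PowerSeries.coeff_X_pow_mul']
      split_ifs with hle
      · rw [PowerSeries.coeff_mul]
        refine Finset.sum_eq_zero fun a ha => ?_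
        rw [Finset.HasAntidiagonal.mem_antidiagonal] at ha
        rw [ih a.2 (by omega), mul_zero]
      · rfl
    rw [hT, map_sub, map_add, show (2 : PowerSeries ℚ) = PowerSeries.C 2 from (map_ofNat _ 2).symm,
      PowerSeries.coeff_C_mul, mul_comm Δ,
      hvanish S _ hS0 fun j hj => by rw [coeff_euler, coeff_euler, ih j hj]; simp,
      hvanish _ Δ (by simp [coeff_euler]) ih,
      hvanish _ _ (by simp [coeff_euler]) fun j hj => by rw [coeff_euler, ih j hj]; simp] at hm
    simp only [coeff_euler] at hm
    push_cast at hm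
    have hf : PowerSeries.coeff 1 S * (((m : ℚ) - 1) ^ 2 * PowerSeries.coeff m Δ) = 0 := by
      linear_combination hm
    rcases eq_or_ne m 1 with rfl | hne
    · exact hΔ
    · have : ((m : ℚ) - 1) ≠ 0 := sub_ne_zero.2 (by exact_mod_cast hne)
      simpa [hS1, this] using hf

/-- The first six orders of the expansion are determined by the equations and by the terms of
degree at most one. -/
theorem eq_of_levelEq {A B : ℕ → PowerSeries ℚ} (hA : ∀ i ≤ 5, LevelEq A i)
    (hB : ∀ i ≤ 5, LevelEq B i) (hA0 : PowerSeries.coeff 0 (A 0) = 0)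
    (hB0 : PowerSeries.coeff 0 (B 0) = 0) (hA1 : PowerSeries.coeff 1 (A 0) = 1)
    (h1 : ∀ i ≤ 5, PowerSeries.coeff 1 (A i) = PowerSeries.coeff 1 (B i)) :
    ∀ i ≤ 5, A i = B i := by
  have hΔ : ∀ i ≤ 5, PowerSeries.coeff 1 (A i - B i) = 0 := fun i hi => by
    rw [map_sub, h1 i hi, sub_self]
  have e0 : A 0 = B 0 := by
    have a := hA 0 (by norm_num)
    have b := hB 0 (by norm_num)
    simp only [LevelEq, Finset.Nat.antidiagonal_zero, Finset.sum_singleton] at a b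
    refine sub_eq_zero.1 (eq_zero_of_linearized (S := A 0 + B 0)
      (T := 8 * (A 0 ^ 2 + A 0 * B 0 + B 0 ^ 2)) ?_ ?_ (hΔ 0 (by norm_num)) ?_)
    · rw [map_add, hA0, hB0, add_zero]
    · rw [map_add, ← h1 0 (by norm_num), hA1]
      norm_num
    · simp only [euler_add, euler_sub]
      simp only [if_true, if_neg (show (0 : ℕ) ≠ 2 by norm_num)] at a b
      linear_combination 2 * a - 2 * b
  have step : ∀ i ≤ 5, A 0 * euler (euler (A i - B i)) + (A i - B i) * euler (euler (A 0))
      - 2 * (euler (A 0) * euler (A i - B i))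
      = PowerSeries.X ^ 2 * (12 * A 0 ^ 2 * (A i - B i)) → A i = B i := fun i hi h =>
    sub_eq_zero.1 (eq_zero_of_linearized hA0 (by simp [hA1]) (hΔ i hi) h)
  have e1 : A 1 = B 1 := by
    refine step 1 (by norm_num) ?_
    have a := hA 1 (by norm_num)
    have b := hB 1 (by norm_num)
    simp [LevelEq, Finset.Nat.antidiagonal_succ, ← e0] at a b
    simp only [euler_sub]
    linear_combination a - b
  have e2 : A 2 = B 2 := by
    refine step 2 (by norm_num) ?_
    have a := hA 2 (by norm_num)
    have b := hB 2 (by norm_num)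
    simp [LevelEq, Finset.Nat.antidiagonal_succ, ← e0, ← e1] at a b
    simp only [euler_sub]
    linear_combination a - b
  have e3 : A 3 = B 3 := by
    refine step 3 (by norm_num) ?_
    have a := hA 3 (by norm_num)
    have b := hB 3 (by norm_num)
    simp [LevelEq, Finset.Nat.antidiagonal_succ, ← e0, ← e1, ← e2] at a b
    simp only [euler_sub]
    linear_combination a - b
  have e4 : A 4 = B 4 := by
    refine step 4 (by norm_num) ?_
    have a := hA 4 (by norm_num)
    have b := hB 4 (by norm_num)
    simp [LevelEq, Finset.Nat.antidiagonal_succ, ← e0, ← e1, ← e2, ← e3] at a b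
    simp only [euler_sub]
    linear_combination a - b
  have e5 : A 5 = B 5 := by
    refine step 5 (by norm_num) ?_
    have a := hA 5 (by norm_num)
    have b := hB 5 (by norm_num)
    simp [LevelEq, Finset.Nat.antidiagonal_succ, ← e0, ← e1, ← e2, ← e3, ← e4] at a b
    simp only [euler_sub]
    linear_combination a - b
  intro i hi
  interval_cases i <;> assumption

/-- The polynomial `1 - 2t/9`, the denominator of `D` in the variable `t = z³`. -/
noncomputable def den : ℚ[X] := 1 - C (2 / 9) * X

/-- The rational function `z ^ e * N(z³) / (1 - 2z³/9) ^ n` as a power series. -/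
noncomputable def ratForm (e n : ℕ) (N : ℚ[X]) : PowerSeries ℚ :=
  PowerSeries.X ^ e * aeval (PowerSeries.X ^ 3 : PowerSeries ℚ) N * D ^ n

/-- The numerator of the Euler derivative of `ratForm e n N`. -/
noncomputable def thetaNumer (e n : ℕ) (N : ℚ[X]) : ℚ[X] :=
  (C (e : ℚ) * N + C 3 * X * derivative N) * den + C (2 * (n : ℚ) / 3) * X * N

theorem aeval_C_eq (t : PowerSeries ℚ) (a : ℚ) : aeval t (C a) = PowerSeries.C a := by
  rw [aeval_C]
  rfl

theorem aeval_den_mul_D : aeval (PowerSeries.X ^ 3 : PowerSeries ℚ) den * D = 1 := by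
  rw [den, map_sub, map_one, map_mul, aeval_C_eq, aeval_X, D]
  exact PowerSeries.mul_inv_cancel _ (by simp)

theorem aeval_den_pow_mul_D_pow (k n : ℕ) :
    aeval (PowerSeries.X ^ 3 : PowerSeries ℚ) den ^ k * D ^ (k + n) = D ^ n := by
  rw [pow_add, ← mul_assoc, ← mul_pow, aeval_den_mul_D, one_pow, one_mul]

theorem euler_D : euler D = PowerSeries.C (2 / 3) * PowerSeries.X ^ 3 * D ^ 2 := by
  have h := congrArg euler aeval_den_mul_D
  have h1 := aeval_den_mul_D
  rw [euler_mul] at h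
  have h2 : euler (aeval (PowerSeries.X ^ 3 : PowerSeries ℚ) den)
      = -(PowerSeries.C (2 / 3) * PowerSeries.X ^ 3) := by
    rw [den, map_sub, map_one, map_mul, aeval_C_eq, aeval_X, euler_sub, euler_mul, euler_C,
      euler_X_pow, ← map_one PowerSeries.C, euler_C,
      show (2 / 3 : ℚ) = 2 / 9 * 3 by norm_num, map_mul, map_ofNat]
    push_cast
    ring
  have h3 : euler (1 : PowerSeries ℚ) = 0 := by rw [← map_one PowerSeries.C, euler_C]
  rw [h2, h3] at h
  linear_combination D * h - euler D * h1

theorem euler_D_pow (n : ℕ) :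
    euler (D ^ n) = PowerSeries.C (2 * (n : ℚ) / 3) * PowerSeries.X ^ 3 * D ^ (n + 1) := by
  cases n with
  | zero => simp [euler]
  | succ n =>
    rw [euler_pow, euler_D, show 2 * ((n + 1 : ℕ) : ℚ) / 3 = (n + 1) * (2 / 3) by push_cast; ring,
      map_mul, map_add, map_natCast, map_one]
    ring

theorem euler_aeval (N : ℚ[X]) :
    euler (aeval (PowerSeries.X ^ 3 : PowerSeries ℚ) N) =
      3 * PowerSeries.X ^ 3 * aeval (PowerSeries.X ^ 3 : PowerSeries ℚ) (derivative N) := by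
  induction N using Polynomial.induction_on' with
  | add p q hp hq => rw [map_add (aeval _), euler_add, hp, hq, derivative_add, map_add]; ring
  | monomial n r =>
    rw [derivative_monomial, ← C_mul_X_pow_eq_monomial, ← C_mul_X_pow_eq_monomial]
    simp only [map_mul, map_pow, aeval_C_eq, aeval_X, euler_mul, euler_C, map_natCast]
    cases n with
    | zero => simp [euler]
    | succ n =>
      rw [euler_pow, euler_X_pow]
      simp only [add_tsub_cancel_right]
      push_cast
      ring

theorem euler_ratForm (e n : ℕ) (N : ℚ[X]) :
    euler (ratForm e n N) = ratForm e (n + 1) (thetaNumer e n N) := by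
  simp only [ratForm, thetaNumer, euler_mul, euler_X_pow, euler_D_pow, euler_aeval, map_add,
    map_mul, aeval_C_eq, aeval_X, map_natCast, map_ofNat]
  linear_combination -(PowerSeries.X ^ e * D ^ n * (e * aeval (PowerSeries.X ^ 3) N
    + 3 * PowerSeries.X ^ 3 * aeval (PowerSeries.X ^ 3) (derivative N))) * aeval_den_mul_D

/-- The numerators of the first six orders of the scaled solution, as polynomials in `z³`, over
the denominator `(1 - 2z³/9) ^ (i + 2)`. -/
noncomputable def numer : ℕ → ℚ[X]
  | 0 => 1
  | 1 => C (1 / 25) * den ^ 3 + C (6 / 25) * den ^ 2 - C (18 / 5) * den + C (108 / 25)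
  | 2 => C (-8 / 16875) * X * den ^ 4 + C (1108 / 91875) * den ^ 4 + C (153 / 6125) * den ^ 3
    + C (4761 / 30625) * den ^ 2 - C (60318 / 30625) * den + C (1944 / 625)
  | 3 => C (-32 / 2953125) * X ^ 2 * den ^ 5 - C (8752 / 4134375) * X * den ^ 5
    + C (68258 / 2296875) * den ^ 5 + C (116878 / 459375) * den ^ 3
    + C (8086604 / 2296875) * den ^ 2 - C (9771516 / 765625) * den + C (139968 / 15625)
  | 4 => C (256 / 13953515625) * X ^ 4 * den ^ 6 - C (78928 / 45581484375) * X ^ 3 * den ^ 6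
    - C (17694848 / 1838453203125) * X ^ 2 * den ^ 6 - C (330698309 / 81709031250) * X * den ^ 6
    + C (61927956 / 3242421875) * den ^ 6 + C (48238574611 / 453939062500) * den ^ 5
    - C (1400615705869 / 453939062500) * den ^ 4 + C (1407265401 / 2316015625) * den ^ 3
    + C (59441369643 / 1875781250) * den ^ 2 - C (1024460784 / 19140625) * den
    + C (1889568 / 78125)
  | 5 => C (131072 / 197791083984375) * X ^ 4 * den ^ 7
    + C (90116032 / 564070869140625) * X ^ 3 * den ^ 7
    - C (324630499328 / 23302394349609375) * X ^ 2 * den ^ 7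
    + C (4366976622 / 9785166015625) * X * den ^ 7 - C (385406999424 / 68496162109375) * den ^ 7
    + C (4531503785253 / 479473134765625) * den ^ 6
    + C (59545228803909 / 479473134765625) * den ^ 5
    - C (37276082380518 / 13699232421875) * den ^ 4 + C (14383449268992 / 2837119140625) * den ^ 3
    + C (268395996744 / 23447265625) * den ^ 2 - C (13329012672 / 478515625) * den
    + C (136048896 / 9765625)
  | _ => 0

theorem eval_numer_zero (x : ℚ) : (numer 0).eval x = 1 := by
  simp [numer]

theorem eval_thetaNumer_zero (x : ℚ) : (thetaNumer 1 2 (numer 0)).eval x = 1 + 10 / 9 * x := by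
  simp [thetaNumer, numer, den]
  ring

theorem eval_thetaNumer_thetaNumer_zero (x : ℚ) :
    (thetaNumer 1 3 (thetaNumer 1 2 (numer 0))).eval x =
    1 + 56 / 9 * x + 100 / 81 * x ^ 2 := by
  simp [thetaNumer, numer, den]
  ring

theorem eval_numer_one (x : ℚ) : (numer 1).eval x = 1 + 2 / 3 * x + 4 / 225 * x ^ 2
    - 8 / 18225 * x ^ 3 := by
  simp [numer, den]
  ring

theorem eval_thetaNumer_one (x : ℚ) : (thetaNumer 0 3 (numer 1)).eval x = 4 * x
    + 224 / 225 * x ^ 2 + 16 / 2025 * x ^ 3 := by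
  simp [thetaNumer, numer, den, derivative_pow]
  ring

theorem eval_thetaNumer_thetaNumer_one (x : ℚ) :
    (thetaNumer 0 4 (thetaNumer 0 3 (numer 1))).eval x =
    12 * x + 1048 / 75 * x ^ 2 + 944 / 675 * x ^ 3 + 32 / 6075 * x ^ 4 := by
  simp [thetaNumer, numer, den, derivative_pow]
  ring

theorem eval_numer_two (x : ℚ) : (numer 2).eval x = 4 / 3 + 46 / 135 * x + 4576 / 297675 * x ^ 2
    - 9032 / 9568125 * x ^ 3 + 30272 / 602791875 * x ^ 4 - 128 / 110716875 * x ^ 5 := by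
  simp [numer, den]
  ring

theorem eval_thetaNumer_two (x : ℚ) : (thetaNumer 2 4 (numer 2)).eval x = 8 / 3 + 14 / 3 * x
    + 64796 / 99225 * x ^ 2 + 219736 / 66976875 * x ^ 3 + 944 / 1913625 * x ^ 4
    - 75904 / 1808375625 * x ^ 5 + 256 / 199290375 * x ^ 6 := by
  simp [thetaNumer, numer, den, derivative_pow]
  ring

theorem eval_thetaNumer_thetaNumer_two (x : ℚ) :
    (thetaNumer 2 5 (thetaNumer 2 4 (numer 2))).eval x =
    16 / 3 + 838 / 27 * x + 1547368 / 99225 * x ^ 2 + 70452896 / 66976875 * x ^ 3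
    + 5920928 / 602791875 * x ^ 4 - 1092128 / 1808375625 * x ^ 5 + 2165248 / 48826141875 * x ^ 6
    - 512 / 358722675 * x ^ 7 := by
  simp [thetaNumer, numer, den, derivative_pow]
  ring

theorem eval_numer_three (x : ℚ) : (numer 3).eval x = 16 / 15 * x + 8 / 35 * x ^ 2
    - 94928 / 13395375 * x ^ 3 + 355232 / 602791875 * x ^ 4 - 5523776 / 135628171875 * x ^ 5
    + 247808 / 244130709375 * x ^ 6 + 1024 / 174379078125 * x ^ 7 := by
  simp [numer, den]
  ring

theorem eval_thetaNumer_three (x : ℚ) : (thetaNumer 1 5 (numer 3)).eval x = 64 / 15 * x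
    + 568 / 135 * x ^ 2 + 898784 / 2679075 * x ^ 3 - 128384 / 602791875 * x ^ 4
    - 5873024 / 15069796875 * x ^ 5 + 34589312 / 1220653546875 * x ^ 6
    - 8493056 / 10985881921875 * x ^ 7 - 2048 / 224201671875 * x ^ 8 := by
  simp [thetaNumer, numer, den, derivative_pow]
  ring

theorem eval_thetaNumer_thetaNumer_three (x : ℚ) :
    (thetaNumer 1 6 (thetaNumer 1 5 (numer 3))).eval x =
    256 / 15 * x + 5768 / 135 * x ^ 2 + 7308304 / 535815 * x ^ 3 + 13253504 / 22325625 * x ^ 4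
    - 877811456 / 135628171875 * x ^ 5 + 63681152 / 174379078125 * x ^ 6
    - 85341952 / 3661960640625 * x ^ 7 + 45365248 / 98872937296875 * x ^ 8
    + 28672 / 2017815046875 * x ^ 9 := by
  simp [thetaNumer, numer, den, derivative_pow]
  ring

theorem eval_numer_four (x : ℚ) : (numer 4).eval x = 256 / 315 * x ^ 2 + 23374 / 212625 * x ^ 3
    - 903752 / 194500845 * x ^ 4 - 14310101552 / 53609295403125 * x ^ 5
    + 1133213408 / 73103584640625 * x ^ 6 - 56827659296 / 108558823191328125 * x ^ 7
    + 5024195584 / 977029408721953125 * x ^ 8 - 32482304 / 121119348188671875 * x ^ 9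
    + 16384 / 7415470297265625 * x ^ 10 := by
  simp [numer, den]
  ring

theorem eval_thetaNumer_four (x : ℚ) : (thetaNumer 0 6 (numer 4)).eval x = 512 / 105 * x ^ 2
    + 2762 / 875 * x ^ 3 + 265984804 / 1620840375 * x ^ 4 - 12150675184 / 1191317675625 * x ^ 5
    + 81275239264 / 804139431046875 * x ^ 6 - 56827659296 / 5169467771015625 * x ^ 7
    + 51282961088 / 108558823191328125 * x ^ 8 - 206603598848 / 14655441130829296875 * x ^ 9
    + 72992768 / 121119348188671875 * x ^ 10 - 131072 / 22246410891796875 * x ^ 11 := by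
  simp [thetaNumer, numer, den, derivative_pow]
  ring

theorem eval_thetaNumer_thetaNumer_four (x : ℚ) :
    (thetaNumer 0 7 (thetaNumer 0 6 (numer 4))).eval x =
    1024 / 35 * x ^ 2 + 50246 / 1125 * x ^ 3 + 5611760032 / 540280125 * x ^ 4
    + 13915835608 / 79421178375 * x ^ 5 - 1052517039872 / 89348825671875 * x ^ 6
    - 1971802912864 / 12062091465703125 * x ^ 7 + 410263688704 / 36186274397109375 * x ^ 8
    - 1132640407424 / 1628382347869921875 * x ^ 9 + 1621305638912 / 43966323392487890625 * x ^ 10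
    - 508604416 / 363358044566015625 * x ^ 11 + 1048576 / 66739232675390625 * x ^ 12 := by
  simp [thetaNumer, numer, den, derivative_pow]
  ring

theorem eval_numer_five (x : ℚ) : (numer 5).eval x = 4864 / 8505 * x ^ 2
    + 213656 / 4209975 * x ^ 3 - 281741095184 / 51771262417875 * x ^ 4
    + 783598437184 / 81539738308153125 * x ^ 5 - 60749554795648 / 6115480373111484375 * x ^ 6
    + 16481555225984 / 23588281439144296875 * x ^ 7
    - 675329414134016 / 26536816619037333984375 * x ^ 8
    + 18574155862016 / 37151543266652267578125 * x ^ 9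
    - 30083096576 / 8093800442707998046875 * x ^ 10 - 16777216 / 946028623173662109375 * x ^ 11 := by
  simp [numer, den]
  ring

theorem eval_thetaNumer_five (x : ℚ) : (thetaNumer 2 7 (numer 5)).eval x = 38912 / 8505 * x ^ 2
    + 281992 / 127575 * x ^ 3 + 270609468032 / 7395894631125 * x ^ 4
    - 676944509768672 / 81539738308153125 * x ^ 5 - 697650720060416 / 3669288223866890625 * x ^ 6
    + 2289033062609536 / 165117970074010078125 * x ^ 7
    - 25799342380476416 / 26536816619037333984375 * x ^ 8
    + 572098659114496 / 13374555575994816328125 * x ^ 9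
    - 15162975469764608 / 15046375022994168369140625 * x ^ 10
    + 56055775232 / 6622200362215634765625 * x ^ 11 + 67108864 / 1216322515508994140625 * x ^ 12 := by
  simp [thetaNumer, numer, den, derivative_pow]
  ring

theorem eval_thetaNumer_thetaNumer_five (x : ℚ) :
    (thetaNumer 2 8 (thetaNumer 2 7 (numer 5))).eval x =
    311296 / 8505 * x ^ 2 + 2218808 / 54675 * x ^ 3 + 7287970593424 / 1056556375875 * x ^ 4
    - 542013855475936 / 9059970923128125 * x ^ 5 - 1363091779667008 / 81539738308153125 * x ^ 6
    + 8247243879200896 / 55039323358003359375 * x ^ 7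
    - 152711927688678656 / 6879915419750419921875 * x ^ 8
    + 34521471925227008 / 20639746259251259765625 * x ^ 9
    - 400112846308529152 / 5015458340998056123046875 * x ^ 10
    + 94242522228801536 / 45139125068982505107421875 * x ^ 11
    - 369423450112 / 19866601086646904296875 * x ^ 12
    - 268435456 / 1563843234225849609375 * x ^ 13 := by
  simp [thetaNumer, numer, den, derivative_pow]
  ring

/-- The first six orders of the scaled solution. -/
noncomputable def closedForm (i : ℕ) : PowerSeries ℚ :=
  ratForm ([1, 0, 2, 1, 0, 2].getD i 0) (i + 2) (numer i)

theorem eval_den (x : ℚ) : den.eval x = 1 - 2 / 9 * x := by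
  simp [den]

theorem numer_identity_zero :
    (numer 0 * thetaNumer 1 3 (thetaNumer 1 2 (numer 0))
        - thetaNumer 1 2 (numer 0) * thetaNumer 1 2 (numer 0))
      = 4 * (X * (numer 0 * numer 0 * numer 0)) := by
  refine Polynomial.funext fun x => ?_
  simp only [eval_sub, eval_mul, eval_X, eval_ofNat, eval_numer_zero,
      eval_thetaNumer_zero, eval_thetaNumer_thetaNumer_zero]
  ring

theorem numer_identity_one :
    (numer 0 * thetaNumer 0 4 (thetaNumer 0 3 (numer 1))
        - thetaNumer 1 2 (numer 0) * thetaNumer 0 3 (numer 1))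
      + (numer 1 * thetaNumer 1 3 (thetaNumer 1 2 (numer 0))
          - thetaNumer 0 3 (numer 1) * thetaNumer 1 2 (numer 0))
      - numer 0 * den ^ 5
      = 4 * (3 * X * (numer 0 * numer 0 * numer 1)) := by
  refine Polynomial.funext fun x => ?_
  simp only [eval_add, eval_sub, eval_mul, eval_pow, eval_X, eval_ofNat, eval_den,
      eval_numer_zero, eval_thetaNumer_zero, eval_thetaNumer_thetaNumer_zero, eval_numer_one,
      eval_thetaNumer_one, eval_thetaNumer_thetaNumer_one]
  ring

theorem numer_identity_two :
    X * (numer 0 * thetaNumer 2 5 (thetaNumer 2 4 (numer 2))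
        - thetaNumer 1 2 (numer 0) * thetaNumer 2 4 (numer 2))
      + (numer 1 * thetaNumer 0 4 (thetaNumer 0 3 (numer 1))
          - thetaNumer 0 3 (numer 1) * thetaNumer 0 3 (numer 1))
      + X * (numer 2 * thetaNumer 1 3 (thetaNumer 1 2 (numer 0))
          - thetaNumer 2 4 (numer 2) * thetaNumer 1 2 (numer 0))
      - numer 1 * den ^ 5 + den ^ 8
      = 4 * (3 * X ^ 2 * (numer 0 * numer 0 * numer 2)
        + 3 * X * (numer 0 * numer 1 * numer 1)) := by
  refine Polynomial.funext fun x => ?_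
  simp only [eval_add, eval_sub, eval_mul, eval_pow, eval_X, eval_ofNat, eval_den,
      eval_numer_zero, eval_thetaNumer_zero, eval_thetaNumer_thetaNumer_zero, eval_numer_one,
      eval_thetaNumer_one, eval_thetaNumer_thetaNumer_one, eval_numer_two, eval_thetaNumer_two,
      eval_thetaNumer_thetaNumer_two]
  ring

theorem numer_identity_three :
    (numer 0 * thetaNumer 1 6 (thetaNumer 1 5 (numer 3))
        - thetaNumer 1 2 (numer 0) * thetaNumer 1 5 (numer 3))
      + (numer 1 * thetaNumer 2 5 (thetaNumer 2 4 (numer 2))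
          - thetaNumer 0 3 (numer 1) * thetaNumer 2 4 (numer 2))
      + (numer 2 * thetaNumer 0 4 (thetaNumer 0 3 (numer 1))
          - thetaNumer 2 4 (numer 2) * thetaNumer 0 3 (numer 1))
      + (numer 3 * thetaNumer 1 3 (thetaNumer 1 2 (numer 0))
          - thetaNumer 1 5 (numer 3) * thetaNumer 1 2 (numer 0))
      - numer 2 * den ^ 5
      = 4 * (3 * X * (numer 0 * numer 0 * numer 3)
        + 6 * X * (numer 0 * numer 1 * numer 2)
        + (numer 1 * numer 1 * numer 1)) := by
  refine Polynomial.funext fun x => ?_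
  simp only [eval_add, eval_sub, eval_mul, eval_pow, eval_X, eval_ofNat, eval_den,
      eval_numer_zero, eval_thetaNumer_zero, eval_thetaNumer_thetaNumer_zero, eval_numer_one,
      eval_thetaNumer_one, eval_thetaNumer_thetaNumer_one, eval_numer_two, eval_thetaNumer_two,
      eval_thetaNumer_thetaNumer_two, eval_numer_three, eval_thetaNumer_three,
      eval_thetaNumer_thetaNumer_three]
  ring

theorem numer_identity_four :
    (numer 0 * thetaNumer 0 7 (thetaNumer 0 6 (numer 4))
        - thetaNumer 1 2 (numer 0) * thetaNumer 0 6 (numer 4))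
      + (numer 1 * thetaNumer 1 6 (thetaNumer 1 5 (numer 3))
          - thetaNumer 0 3 (numer 1) * thetaNumer 1 5 (numer 3))
      + X * (numer 2 * thetaNumer 2 5 (thetaNumer 2 4 (numer 2))
          - thetaNumer 2 4 (numer 2) * thetaNumer 2 4 (numer 2))
      + (numer 3 * thetaNumer 0 4 (thetaNumer 0 3 (numer 1))
          - thetaNumer 1 5 (numer 3) * thetaNumer 0 3 (numer 1))
      + (numer 4 * thetaNumer 1 3 (thetaNumer 1 2 (numer 0))
          - thetaNumer 0 6 (numer 4) * thetaNumer 1 2 (numer 0))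
      - numer 3 * den ^ 5
      = 4 * (3 * X * (numer 0 * numer 0 * numer 4)
        + 6 * X * (numer 0 * numer 1 * numer 3)
        + 3 * X ^ 2 * (numer 0 * numer 2 * numer 2)
        + 3 * X * (numer 1 * numer 1 * numer 2)) := by
  refine Polynomial.funext fun x => ?_
  simp only [eval_add, eval_sub, eval_mul, eval_pow, eval_X, eval_ofNat, eval_den,
      eval_numer_zero, eval_thetaNumer_zero, eval_thetaNumer_thetaNumer_zero, eval_numer_one,
      eval_thetaNumer_one, eval_thetaNumer_thetaNumer_one, eval_numer_two, eval_thetaNumer_two,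
      eval_thetaNumer_thetaNumer_two, eval_numer_three, eval_thetaNumer_three,
      eval_thetaNumer_thetaNumer_three, eval_numer_four, eval_thetaNumer_four,
      eval_thetaNumer_thetaNumer_four]
  ring

theorem numer_identity_five :
    X * (numer 0 * thetaNumer 2 8 (thetaNumer 2 7 (numer 5))
        - thetaNumer 1 2 (numer 0) * thetaNumer 2 7 (numer 5))
      + (numer 1 * thetaNumer 0 7 (thetaNumer 0 6 (numer 4))
          - thetaNumer 0 3 (numer 1) * thetaNumer 0 6 (numer 4))
      + X * (numer 2 * thetaNumer 1 6 (thetaNumer 1 5 (numer 3))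
          - thetaNumer 2 4 (numer 2) * thetaNumer 1 5 (numer 3))
      + X * (numer 3 * thetaNumer 2 5 (thetaNumer 2 4 (numer 2))
          - thetaNumer 1 5 (numer 3) * thetaNumer 2 4 (numer 2))
      + (numer 4 * thetaNumer 0 4 (thetaNumer 0 3 (numer 1))
          - thetaNumer 0 6 (numer 4) * thetaNumer 0 3 (numer 1))
      + X * (numer 5 * thetaNumer 1 3 (thetaNumer 1 2 (numer 0))
          - thetaNumer 2 7 (numer 5) * thetaNumer 1 2 (numer 0))
      - numer 4 * den ^ 5
      = 4 * (3 * X ^ 2 * (numer 0 * numer 0 * numer 5)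
        + 6 * X * (numer 0 * numer 1 * numer 4)
        + 6 * X ^ 2 * (numer 0 * numer 2 * numer 3)
        + 3 * X * (numer 1 * numer 1 * numer 3)
        + 3 * X ^ 2 * (numer 1 * numer 2 * numer 2)) := by
  refine Polynomial.funext fun x => ?_
  simp only [eval_add, eval_sub, eval_mul, eval_pow, eval_X, eval_ofNat, eval_den,
      eval_numer_zero, eval_thetaNumer_zero, eval_thetaNumer_thetaNumer_zero, eval_numer_one,
      eval_thetaNumer_one, eval_thetaNumer_thetaNumer_one, eval_numer_two, eval_thetaNumer_two,
      eval_thetaNumer_thetaNumer_two, eval_numer_three, eval_thetaNumer_three,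
      eval_thetaNumer_thetaNumer_three, eval_numer_four, eval_thetaNumer_four,
      eval_thetaNumer_thetaNumer_four, eval_numer_five, eval_thetaNumer_five,
      eval_thetaNumer_thetaNumer_five]
  ring

theorem levelEq_closedForm_zero : LevelEq closedForm 0 := by
  have h := congrArg (aeval (PowerSeries.X ^ 3 : PowerSeries ℚ)) numer_identity_zero
  simp only [map_sub, map_mul, aeval_X, map_ofNat] at h
  simp [LevelEq, closedForm, euler_ratForm]
  simp only [ratForm]
  linear_combination PowerSeries.X ^ 2 * D ^ 6 * h

theorem levelEq_closedForm_one : LevelEq closedForm 1 := by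
  have h := congrArg (aeval (PowerSeries.X ^ 3 : PowerSeries ℚ)) numer_identity_one
  simp only [map_add, map_sub, map_mul, map_pow, aeval_X, map_ofNat] at h
  have hD := aeval_den_pow_mul_D_pow 5 2
  simp [LevelEq, Finset.Nat.antidiagonal_succ, closedForm, euler_ratForm]
  simp only [ratForm]
  linear_combination PowerSeries.X * D ^ 7 * h
    + PowerSeries.X * aeval (PowerSeries.X ^ 3) (numer 0) * hD

theorem levelEq_closedForm_two : LevelEq closedForm 2 := by
  have h := congrArg (aeval (PowerSeries.X ^ 3 : PowerSeries ℚ)) numer_identity_two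
  simp only [map_add, map_sub, map_mul, map_pow, aeval_X, map_ofNat] at h
  have hD := aeval_den_pow_mul_D_pow 5 3
  have hD8 := aeval_den_pow_mul_D_pow 8 0
  simp [LevelEq, Finset.Nat.antidiagonal_succ, closedForm, euler_ratForm]
  simp only [ratForm]
  linear_combination D ^ 8 * h
    + aeval (PowerSeries.X ^ 3) (numer 1) * hD - hD8

theorem levelEq_closedForm_three : LevelEq closedForm 3 := by
  have h := congrArg (aeval (PowerSeries.X ^ 3 : PowerSeries ℚ)) numer_identity_three
  simp only [map_add, map_sub, map_mul, map_pow, aeval_X, map_ofNat] at h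
  have hD := aeval_den_pow_mul_D_pow 5 4
  simp [LevelEq, Finset.Nat.antidiagonal_succ, closedForm, euler_ratForm]
  simp only [ratForm]
  linear_combination PowerSeries.X ^ 2 * D ^ 9 * h
    + PowerSeries.X ^ 2 * aeval (PowerSeries.X ^ 3) (numer 2) * hD

theorem levelEq_closedForm_four : LevelEq closedForm 4 := by
  have h := congrArg (aeval (PowerSeries.X ^ 3 : PowerSeries ℚ)) numer_identity_four
  simp only [map_add, map_sub, map_mul, map_pow, aeval_X, map_ofNat] at h
  have hD := aeval_den_pow_mul_D_pow 5 5
  simp [LevelEq, Finset.Nat.antidiagonal_succ, closedForm, euler_ratForm]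
  simp only [ratForm]
  linear_combination PowerSeries.X * D ^ 10 * h
    + PowerSeries.X * aeval (PowerSeries.X ^ 3) (numer 3) * hD

theorem levelEq_closedForm_five : LevelEq closedForm 5 := by
  have h := congrArg (aeval (PowerSeries.X ^ 3 : PowerSeries ℚ)) numer_identity_five
  simp only [map_add, map_sub, map_mul, map_pow, aeval_X, map_ofNat] at h
  have hD := aeval_den_pow_mul_D_pow 5 6
  simp [LevelEq, Finset.Nat.antidiagonal_succ, closedForm, euler_ratForm]
  simp only [ratForm]
  linear_combination D ^ 11 * h
    + aeval (PowerSeries.X ^ 3) (numer 4) * hD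

theorem closedForm_three : closedForm 3 =
    PowerSeries.C (-32 / 2953125 : ℚ) * PowerSeries.X ^ 7
      - PowerSeries.C (8752 / 4134375 : ℚ) * PowerSeries.X ^ 4
      + PowerSeries.C (68258 / 2296875 : ℚ) * PowerSeries.X
      + PowerSeries.C (116878 / 459375 : ℚ) * PowerSeries.X * D ^ 2
      + PowerSeries.C (8086604 / 2296875 : ℚ) * PowerSeries.X * D ^ 3
      - PowerSeries.C (9771516 / 765625 : ℚ) * PowerSeries.X * D ^ 4
      + PowerSeries.C (139968 / 15625 : ℚ) * PowerSeries.X * D ^ 5 := by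
  simp [closedForm, ratForm, numer, aeval_C_eq, -map_neg, -aeval_C]
  linear_combination (PowerSeries.C (-32 / 2953125) * PowerSeries.X ^ 7
      - PowerSeries.C (8752 / 4134375) * PowerSeries.X ^ 4
      + PowerSeries.C (68258 / 2296875) * PowerSeries.X) * aeval_den_pow_mul_D_pow 5 0
    + PowerSeries.X * PowerSeries.C (116878 / 459375) * aeval_den_pow_mul_D_pow 3 2
    + PowerSeries.X * PowerSeries.C (8086604 / 2296875) * aeval_den_pow_mul_D_pow 2 3
    - PowerSeries.X * PowerSeries.C (9771516 / 765625) * aeval_den_pow_mul_D_pow 1 4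

theorem closedForm_four : closedForm 4 =
    PowerSeries.C (256 / 13953515625 : ℚ) * PowerSeries.X ^ 12
      - PowerSeries.C (78928 / 45581484375 : ℚ) * PowerSeries.X ^ 9
      - PowerSeries.C (17694848 / 1838453203125 : ℚ) * PowerSeries.X ^ 6
      - PowerSeries.C (330698309 / 81709031250 : ℚ) * PowerSeries.X ^ 3
      + PowerSeries.C (61927956 / 3242421875 : ℚ)
      + PowerSeries.C (48238574611 / 453939062500 : ℚ) * D
      - PowerSeries.C (1400615705869 / 453939062500 : ℚ) * D ^ 2
      + PowerSeries.C (1407265401 / 2316015625 : ℚ) * D ^ 3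
      + PowerSeries.C (59441369643 / 1875781250 : ℚ) * D ^ 4
      - PowerSeries.C (1024460784 / 19140625 : ℚ) * D ^ 5
      + PowerSeries.C (1889568 / 78125 : ℚ) * D ^ 6 := by
  simp [closedForm, ratForm, numer, aeval_C_eq, -map_neg, -aeval_C]
  linear_combination (PowerSeries.C (256 / 13953515625) * PowerSeries.X ^ 12
      - PowerSeries.C (78928 / 45581484375) * PowerSeries.X ^ 9
      - PowerSeries.C (17694848 / 1838453203125) * PowerSeries.X ^ 6
      - PowerSeries.C (330698309 / 81709031250) * PowerSeries.X ^ 3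
      + PowerSeries.C (61927956 / 3242421875)) * aeval_den_pow_mul_D_pow 6 0
    + PowerSeries.C (48238574611 / 453939062500) * aeval_den_pow_mul_D_pow 5 1
    - PowerSeries.C (1400615705869 / 453939062500) * aeval_den_pow_mul_D_pow 4 2
    + PowerSeries.C (1407265401 / 2316015625) * aeval_den_pow_mul_D_pow 3 3
    + PowerSeries.C (59441369643 / 1875781250) * aeval_den_pow_mul_D_pow 2 4
    - PowerSeries.C (1024460784 / 19140625) * aeval_den_pow_mul_D_pow 1 5

theorem closedForm_five : closedForm 5 =
    PowerSeries.C (131072 / 197791083984375 : ℚ) * PowerSeries.X ^ 14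
      + PowerSeries.C (90116032 / 564070869140625 : ℚ) * PowerSeries.X ^ 11
      - PowerSeries.C (324630499328 / 23302394349609375 : ℚ) * PowerSeries.X ^ 8
      + PowerSeries.C (4366976622 / 9785166015625 : ℚ) * PowerSeries.X ^ 5
      - PowerSeries.C (385406999424 / 68496162109375 : ℚ) * PowerSeries.X ^ 2
      + PowerSeries.C (4531503785253 / 479473134765625 : ℚ) * PowerSeries.X ^ 2 * D
      + PowerSeries.C (59545228803909 / 479473134765625 : ℚ) * PowerSeries.X ^ 2 * D ^ 2
      - PowerSeries.C (37276082380518 / 13699232421875 : ℚ) * PowerSeries.X ^ 2 * D ^ 3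
      + PowerSeries.C (14383449268992 / 2837119140625 : ℚ) * PowerSeries.X ^ 2 * D ^ 4
      + PowerSeries.C (268395996744 / 23447265625 : ℚ) * PowerSeries.X ^ 2 * D ^ 5
      - PowerSeries.C (13329012672 / 478515625 : ℚ) * PowerSeries.X ^ 2 * D ^ 6
      + PowerSeries.C (136048896 / 9765625 : ℚ) * PowerSeries.X ^ 2 * D ^ 7 := by
  simp [closedForm, ratForm, numer, aeval_C_eq, -map_neg, -aeval_C]
  linear_combination (PowerSeries.C (131072 / 197791083984375) * PowerSeries.X ^ 14
      + PowerSeries.C (90116032 / 564070869140625) * PowerSeries.X ^ 11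
      - PowerSeries.C (324630499328 / 23302394349609375) * PowerSeries.X ^ 8
      + PowerSeries.C (4366976622 / 9785166015625) * PowerSeries.X ^ 5
      - PowerSeries.C (385406999424 / 68496162109375) * PowerSeries.X ^ 2) *
          aeval_den_pow_mul_D_pow 7 0
    + PowerSeries.X ^ 2 * PowerSeries.C (4531503785253 / 479473134765625) *
        aeval_den_pow_mul_D_pow 6 1
    + PowerSeries.X ^ 2 * PowerSeries.C (59545228803909 / 479473134765625) *
        aeval_den_pow_mul_D_pow 5 2
    - PowerSeries.X ^ 2 * PowerSeries.C (37276082380518 / 13699232421875) *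
        aeval_den_pow_mul_D_pow 4 3
    + PowerSeries.X ^ 2 * PowerSeries.C (14383449268992 / 2837119140625) *
        aeval_den_pow_mul_D_pow 3 4
    + PowerSeries.X ^ 2 * PowerSeries.C (268395996744 / 23447265625) * aeval_den_pow_mul_D_pow 2 5
    - PowerSeries.X ^ 2 * PowerSeries.C (13329012672 / 478515625) * aeval_den_pow_mul_D_pow 1 6

theorem constantCoeff_aeval_X_pow_three (N : ℚ[X]) :
    PowerSeries.constantCoeff (aeval (PowerSeries.X ^ 3 : PowerSeries ℚ) N) = N.eval 0 := by
  induction N using Polynomial.induction_on' with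
  | add p q hp hq => rw [map_add (aeval _), map_add, hp, hq, eval_add]
  | monomial n r =>
    rw [← C_mul_X_pow_eq_monomial]
    simp only [map_mul, map_pow, aeval_C_eq, aeval_X, eval_mul, eval_pow, eval_X, eval_C,
      PowerSeries.constantCoeff_C, PowerSeries.constantCoeff_X]
    rw [zero_pow three_ne_zero]

theorem constantCoeff_D : PowerSeries.constantCoeff D = 1 := by
  simp [D]

theorem coeff_one_ratForm_zero (n : ℕ) (N : ℚ[X]) :
    PowerSeries.coeff 1 (ratForm 0 n N) = 0 := by
  have h := congrArg (PowerSeries.coeff 1) (euler_ratForm 0 n N)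
  rw [coeff_euler, Nat.cast_one, one_mul] at h
  rw [h, thetaNumer, Nat.cast_zero, C_0, zero_mul, zero_add,
    show C 3 * X * derivative N * den + C (2 * (n : ℚ) / 3) * X * N
      = X * (C 3 * derivative N * den + C (2 * (n : ℚ) / 3) * N) by ring, ratForm,
    map_mul (aeval _), aeval_X, pow_zero, one_mul, mul_assoc, PowerSeries.coeff_X_pow_mul',
    if_neg (by norm_num)]

theorem coeff_one_ratForm_one (n : ℕ) (N : ℚ[X]) :
    PowerSeries.coeff 1 (ratForm 1 n N) = N.eval 0 := by
  rw [ratForm, pow_one, mul_assoc, show (1 : ℕ) = 0 + 1 from rfl,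
    PowerSeries.coeff_succ_X_mul, PowerSeries.coeff_zero_eq_constantCoeff_apply, map_mul, map_pow,
    constantCoeff_aeval_X_pow_three, constantCoeff_D, one_pow, mul_one]

theorem coeff_one_ratForm_two (n : ℕ) (N : ℚ[X]) :
    PowerSeries.coeff 1 (ratForm 2 n N) = 0 := by
  rw [ratForm, mul_assoc, PowerSeries.coeff_X_pow_mul', if_neg (by norm_num)]

theorem level_scaledSol_eq_closedForm : ∀ i ≤ 5, level i scaledSol = closedForm i := by
  have h1 : ∀ i, PowerSeries.coeff 1 (level i scaledSol) = if i = 0 then 1 else 0 := fun i => by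
    simp [level, scaledSol, regularPair, coeff_one]
  refine eq_of_levelEq (fun i _ => levelEq_scaledSol i) ?_ ?_ ?_ (by rw [h1, if_pos rfl]) ?_
  · intro i hi
    interval_cases i
    · exact levelEq_closedForm_zero
    · exact levelEq_closedForm_one
    · exact levelEq_closedForm_two
    · exact levelEq_closedForm_three
    · exact levelEq_closedForm_four
    · exact levelEq_closedForm_five
  · simp [level, scaledSol, regularPair]
  · simp [closedForm, ratForm]
  · intro i hi
    rw [h1]
    interval_cases i
    · exact ((coeff_one_ratForm_one _ _).trans (eval_numer_zero 0)).symm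
    · exact (coeff_one_ratForm_zero _ _).symm
    · exact (coeff_one_ratForm_two _ _).symm
    · exact ((coeff_one_ratForm_one _ _).trans ((eval_numer_three 0).trans (by norm_num))).symm
    · exact (coeff_one_ratForm_zero _ _).symm
    · exact (coeff_one_ratForm_two _ _).symm

theorem genFun_one_eq : genFun 1 = closedForm 3 := by
  rw [genFun_eq_level (i := 3) (by norm_num), level_scaledSol_eq_closedForm 3 (by norm_num)]

theorem genFun_zero_eq : genFun 0 = closedForm 4 := by
  rw [genFun_eq_level (i := 4) (by norm_num), level_scaledSol_eq_closedForm 4 (by norm_num)]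

theorem genFun_two_eq : genFun 2 = closedForm 5 := by
  rw [genFun_eq_level (i := 5) (by norm_num), level_scaledSol_eq_closedForm 5 (by norm_num)]

theorem p_eq_coeff_genFun (m : ℕ) : p m 1 = PowerSeries.coeff m (genFun (m % 3)) := by
  simp [genFun]

theorem D_pow_eq_mk (j : ℕ) : D ^ (j + 1) = PowerSeries.mk fun m =>
    if m % 3 = 0 then ((m / 3 + j).choose j : ℚ) * (2 / 9) ^ (m / 3) else 0 := by
  have hden : (1 - PowerSeries.C (2 / 9 : ℚ) * PowerSeries.X ^ 3) * D = 1 :=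
    PowerSeries.mul_inv_cancel _ (by simp)
  induction j with
  | zero =>
    rw [zero_add, pow_one]
    apply mul_left_cancel₀ (left_ne_zero_of_mul_eq_one hden)
    rw [hden]
    ext m
    rw [sub_mul, one_mul, mul_assoc, map_sub, PowerSeries.coeff_C_mul,
      PowerSeries.coeff_X_pow_mul', PowerSeries.coeff_one]
    simp only [PowerSeries.coeff_mk, Nat.choose_zero_right, Nat.cast_one, one_mul]
    rcases lt_or_ge m 3 with h | h
    · interval_cases m <;> simp
    · obtain ⟨n, rfl⟩ := Nat.exists_eq_add_of_le' h
      rw [if_neg (by omega), if_pos h, Nat.add_sub_cancel, Nat.add_mod_right,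
        Nat.add_div_right _ (by norm_num)]
      split_ifs
      · rw [pow_succ]
        ring
      · simp
  | succ j ih =>
    apply mul_left_cancel₀ (left_ne_zero_of_mul_eq_one hden)
    rw [pow_succ' D, ← mul_assoc, hden, one_mul, ih]
    ext m
    rw [sub_mul, one_mul, mul_assoc, map_sub, PowerSeries.coeff_C_mul,
      PowerSeries.coeff_X_pow_mul']
    simp only [PowerSeries.coeff_mk]
    rcases lt_or_ge m 3 with h | h
    · interval_cases m <;> simp
    · obtain ⟨n, rfl⟩ := Nat.exists_eq_add_of_le' h
      rw [if_pos h, Nat.add_sub_cancel, Nat.add_mod_right, Nat.add_div_right _ (by norm_num)]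
      split_ifs
      · rw [pow_succ,
          show n / 3 + 1 + (j + 1) = (n / 3 + 1 + j) + 1 by ring, Nat.choose_succ_succ,
          show n / 3 + (j + 1) = n / 3 + 1 + j by ring]
        push_cast
        ring
      · simp

theorem cast_add_choose (k j : ℕ) :
    ((k + j).choose j : ℚ) = ∏ i ∈ Finset.range j, ((k : ℚ) + i + 1) / (i + 1) := by
  induction j with
  | zero => simp
  | succ j ih =>
    have h : ((k : ℚ) + j + 1) * ((k + j).choose j : ℚ)
        = ((k + j + 1).choose (j + 1) : ℚ) * (j + 1) := by
      exact_mod_cast Nat.add_one_mul_choose_eq (k + j) j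
    have hj : ((j : ℚ) + 1) ≠ 0 := by positivity
    rw [Finset.prod_range_succ, ← ih, mul_div_assoc', mul_comm, h, ← add_assoc,
      mul_div_cancel_right₀ _ hj]

theorem coeff_X_pow_mul_D_pow (e j k : ℕ) :
    PowerSeries.coeff (3 * k + e) (PowerSeries.X ^ e * D ^ (j + 1))
      = (∏ i ∈ Finset.range j, ((k : ℚ) + i + 1) / (i + 1)) * (2 / 9) ^ k := by
  rw [PowerSeries.coeff_X_pow_mul, D_pow_eq_mk, PowerSeries.coeff_mk, if_pos (by omega),
    Nat.mul_div_cancel_left _ (by norm_num), cast_add_choose]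

theorem coeff_X_pow_three_mul_add (e j k : ℕ) :
    PowerSeries.coeff (3 * k + e) (PowerSeries.X ^ (3 * j + e) : PowerSeries ℚ)
      = if k = j then 1 else 0 := by
  rw [PowerSeries.coeff_X_pow]
  exact if_congr (by omega) rfl rfl

theorem p_three_mul_add_one (k : ℕ) : p (3 * k + 1) 1 =
    2 / 5 ^ 6 * (2916 * (k : ℚ) ^ 2 + 328779 / 49 * (k : ℚ) - 34129 / 147)
          * ((k : ℚ) + 1) ^ 2 * (2 / 9) ^ k
      + (-32 / 2953125) * (if k = 2 then 1 else 0)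
      + (-8752 / 4134375) * (if k = 1 then 1 else 0)
      + 68258 / 2296875 * (if k = 0 then 1 else 0) := by
  have hD : ∀ j : ℕ, PowerSeries.coeff (3 * k + 1) (PowerSeries.X * D ^ (j + 1)) =
      (∏ i ∈ Finset.range j, ((k : ℚ) + i + 1) / (i + 1)) * (2 / 9) ^ k := fun j => by
    simpa only [pow_one] using coeff_X_pow_mul_D_pow 1 j k
  have hD2 : PowerSeries.coeff (3 * k + 1) (PowerSeries.X * D ^ 2) = _ := hD 1
  have hD3 : PowerSeries.coeff (3 * k + 1) (PowerSeries.X * D ^ 3) = _ := hD 2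
  have hD4 : PowerSeries.coeff (3 * k + 1) (PowerSeries.X * D ^ 4) = _ := hD 3
  have hD5 : PowerSeries.coeff (3 * k + 1) (PowerSeries.X * D ^ 5) = _ := hD 4
  have hX0 : PowerSeries.coeff (3 * k + 1) (PowerSeries.X : PowerSeries ℚ) =
      if k = 0 then 1 else 0 :=
    by
    simpa only [mul_zero, zero_add, pow_one] using coeff_X_pow_three_mul_add 1 0 k
  have hX1 : PowerSeries.coeff (3 * k + 1) (PowerSeries.X ^ 4 : PowerSeries ℚ) =
      if k = 1 then 1 else 0 :=
    coeff_X_pow_three_mul_add 1 1 k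
  have hX2 : PowerSeries.coeff (3 * k + 1) (PowerSeries.X ^ 7 : PowerSeries ℚ) =
      if k = 2 then 1 else 0 :=
    coeff_X_pow_three_mul_add 1 2 k
  rw [p_eq_coeff_genFun, show (3 * k + 1) % 3 = 1 by omega, genFun_one_eq,
    closedForm_three]
  simp only [map_add, map_sub, mul_assoc, PowerSeries.coeff_C_mul,
    hD2, hD3, hD4, hD5, hX0, hX1, hX2,
    Finset.prod_range_succ, Finset.prod_range_zero]
  push_cast
  ring

theorem p_three_mul (k : ℕ) : p (3 * k) 1 =
    1 / 5 ^ 7 * (8748 / 5 * (k : ℚ) ^ 3 + 223074 / 49 * (k : ℚ) ^ 2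
            - 281982223 / 48020 * (k : ℚ) - 15481989 / 41503)
          * (3 * (k : ℚ) + 2) ^ 2 * (2 / 9) ^ k
      + 256 / 13953515625 * (if k = 4 then 1 else 0)
      + (-78928 / 45581484375) * (if k = 3 then 1 else 0)
      + (-17694848 / 1838453203125) * (if k = 2 then 1 else 0)
      + (-330698309 / 81709031250) * (if k = 1 then 1 else 0)
      + (if k = 0 then 61927956 / 3242421875 else 0) := by
  have hD : ∀ j : ℕ, PowerSeries.coeff (3 * k) (D ^ (j + 1)) =
      (∏ i ∈ Finset.range j, ((k : ℚ) + i + 1) / (i + 1)) * (2 / 9) ^ k := fun j => by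
    simpa only [pow_zero, one_mul, add_zero] using coeff_X_pow_mul_D_pow 0 j k
  have hD1 : PowerSeries.coeff (3 * k) D = _ :=
      (congrArg _ (by rw [zero_add, pow_one])).trans (hD 0)
  have hD2 : PowerSeries.coeff (3 * k) (D ^ 2) = _ := hD 1
  have hD3 : PowerSeries.coeff (3 * k) (D ^ 3) = _ := hD 2
  have hD4 : PowerSeries.coeff (3 * k) (D ^ 4) = _ := hD 3
  have hD5 : PowerSeries.coeff (3 * k) (D ^ 5) = _ := hD 4
  have hD6 : PowerSeries.coeff (3 * k) (D ^ 6) = _ := hD 5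
  have hX1 : PowerSeries.coeff (3 * k) (PowerSeries.X ^ 3 : PowerSeries ℚ) =
      if k = 1 then 1 else 0 :=
    coeff_X_pow_three_mul_add 0 1 k
  have hX2 : PowerSeries.coeff (3 * k) (PowerSeries.X ^ 6 : PowerSeries ℚ) =
      if k = 2 then 1 else 0 :=
    coeff_X_pow_three_mul_add 0 2 k
  have hX3 : PowerSeries.coeff (3 * k) (PowerSeries.X ^ 9 : PowerSeries ℚ) =
      if k = 3 then 1 else 0 :=
    coeff_X_pow_three_mul_add 0 3 k
  have hX4 : PowerSeries.coeff (3 * k) (PowerSeries.X ^ 12 : PowerSeries ℚ) =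
      if k = 4 then 1 else 0 :=
    coeff_X_pow_three_mul_add 0 4 k
  rw [p_eq_coeff_genFun, show (3 * k) % 3 = 0 by omega, genFun_zero_eq,
    closedForm_four]
  simp only [map_add, map_sub, mul_assoc, PowerSeries.coeff_C_mul, PowerSeries.coeff_C,
    show 3 * k = 0 ↔ k = 0 by omega,
    hD1, hD2, hD3, hD4, hD5, hD6, hX1, hX2, hX3, hX4,
    Finset.prod_range_succ, Finset.prod_range_zero]
  push_cast
  ring

theorem p_three_mul_add_two (k : ℕ) : p (3 * k + 2) 1 =
    3 / 5 ^ 10 * (34992 / 5 * (k : ℚ) ^ 4 + 10865016 / 245 * (k : ℚ) ^ 3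
            + 86107493 / 12005 * (k : ℚ) ^ 2 - 86860273454 / 1452605 * (k : ℚ)
            + 8029312488 / 7014007)
          * (3 * (k : ℚ) + 4) ^ 2 * (2 / 9) ^ k
      + 131072 / 197791083984375 * (if k = 4 then 1 else 0)
      + 90116032 / 564070869140625 * (if k = 3 then 1 else 0)
      + (-324630499328 / 23302394349609375) * (if k = 2 then 1 else 0)
      + 4366976622 / 9785166015625 * (if k = 1 then 1 else 0)
      + (-385406999424 / 68496162109375) * (if k = 0 then 1 else 0) := by
  have hD : ∀ j : ℕ, PowerSeries.coeff (3 * k + 2) (PowerSeries.X ^ 2 * D ^ (j + 1)) =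
      (∏ i ∈ Finset.range j, ((k : ℚ) + i + 1) / (i + 1)) * (2 / 9) ^ k := fun j =>
    coeff_X_pow_mul_D_pow 2 j k
  have hD1 : PowerSeries.coeff (3 * k + 2) (PowerSeries.X ^ 2 * D) = _ :=
      (congrArg _ (by rw [zero_add, pow_one])).trans (hD 0)
  have hD2 : PowerSeries.coeff (3 * k + 2) (PowerSeries.X ^ 2 * D ^ 2) = _ := hD 1
  have hD3 : PowerSeries.coeff (3 * k + 2) (PowerSeries.X ^ 2 * D ^ 3) = _ := hD 2
  have hD4 : PowerSeries.coeff (3 * k + 2) (PowerSeries.X ^ 2 * D ^ 4) = _ := hD 3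
  have hD5 : PowerSeries.coeff (3 * k + 2) (PowerSeries.X ^ 2 * D ^ 5) = _ := hD 4
  have hD6 : PowerSeries.coeff (3 * k + 2) (PowerSeries.X ^ 2 * D ^ 6) = _ := hD 5
  have hD7 : PowerSeries.coeff (3 * k + 2) (PowerSeries.X ^ 2 * D ^ 7) = _ := hD 6
  have hX0 : PowerSeries.coeff (3 * k + 2) (PowerSeries.X ^ 2 : PowerSeries ℚ) =
      if k = 0 then 1 else 0 :=
    coeff_X_pow_three_mul_add 2 0 k
  have hX1 : PowerSeries.coeff (3 * k + 2) (PowerSeries.X ^ 5 : PowerSeries ℚ) =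
      if k = 1 then 1 else 0 :=
    coeff_X_pow_three_mul_add 2 1 k
  have hX2 : PowerSeries.coeff (3 * k + 2) (PowerSeries.X ^ 8 : PowerSeries ℚ) =
      if k = 2 then 1 else 0 :=
    coeff_X_pow_three_mul_add 2 2 k
  have hX3 : PowerSeries.coeff (3 * k + 2) (PowerSeries.X ^ 11 : PowerSeries ℚ) =
      if k = 3 then 1 else 0 :=
    coeff_X_pow_three_mul_add 2 3 k
  have hX4 : PowerSeries.coeff (3 * k + 2) (PowerSeries.X ^ 14 : PowerSeries ℚ) =
      if k = 4 then 1 else 0 :=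
    coeff_X_pow_three_mul_add 2 4 k
  rw [p_eq_coeff_genFun, show (3 * k + 2) % 3 = 2 by omega, genFun_two_eq,
    closedForm_five]
  simp only [map_add, map_sub, mul_assoc, PowerSeries.coeff_C_mul,
    hD1, hD2, hD3, hD4, hD5, hD6, hD7, hX0, hX1, hX2, hX3, hX4,
    Finset.prod_range_succ, Finset.prod_range_zero]
  push_cast
  ring

end DegeneratePIII


open DegeneratePIII in
theorem proposition3p2 :
    -- the coefficients `p_{3k+1,1}`
    (p 4 1 = 16 / 15 ∧ p 7 1 = 1336 / 945 ∧
      ∀ k : ℕ, 3 ≤ k → p (3 * k + 1) 1 =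
        2 / 5 ^ 6 * (2916 * (k : ℚ) ^ 2 + 328779 / 49 * (k : ℚ) - 34129 / 147)
          * ((k : ℚ) + 1) ^ 2 * (2 / 9) ^ k) ∧
    -- the coefficients `p_{3k,1}`
    (p 6 1 = 256 / 315 ∧ p 9 1 = 253774 / 212625 ∧ p 12 1 = 4788251008 / 4862521125 ∧
      ∀ k : ℕ, 5 ≤ k → p (3 * k) 1 =
        1 / 5 ^ 7 * (8748 / 5 * (k : ℚ) ^ 3 + 223074 / 49 * (k : ℚ) ^ 2
            - 281982223 / 48020 * (k : ℚ) - 15481989 / 41503)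
          * (3 * (k : ℚ) + 2) ^ 2 * (2 / 9) ^ k) ∧
    -- the coefficients `p_{3k+2,1}`
    (p 8 1 = 4864 / 8505 ∧ p 11 1 = 3958936 / 4209975 ∧
      p 14 1 = 44744664088576 / 51771262417875 ∧
      ∀ k : ℕ, 5 ≤ k → p (3 * k + 2) 1 =
        3 / 5 ^ 10 * (34992 / 5 * (k : ℚ) ^ 4 + 10865016 / 245 * (k : ℚ) ^ 3
            + 86107493 / 12005 * (k : ℚ) ^ 2 - 86860273454 / 1452605 * (k : ℚ)
            + 8029312488 / 7014007)
          * (3 * (k : ℚ) + 4) ^ 2 * (2 / 9) ^ k) ∧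
    -- the generating function `A₃`
    (genFun 1 =
      PowerSeries.C (-32 / 2953125 : ℚ) * PowerSeries.X ^ 7
      - PowerSeries.C (8752 / 4134375 : ℚ) * PowerSeries.X ^ 4
      + PowerSeries.C (68258 / 2296875 : ℚ) * PowerSeries.X
      + PowerSeries.C (116878 / 459375 : ℚ) * PowerSeries.X * D ^ 2
      + PowerSeries.C (8086604 / 2296875 : ℚ) * PowerSeries.X * D ^ 3
      - PowerSeries.C (9771516 / 765625 : ℚ) * PowerSeries.X * D ^ 4
      + PowerSeries.C (139968 / 15625 : ℚ) * PowerSeries.X * D ^ 5) ∧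
    -- the generating function `A₄`
    (genFun 0 =
      PowerSeries.C (256 / 13953515625 : ℚ) * PowerSeries.X ^ 12
      - PowerSeries.C (78928 / 45581484375 : ℚ) * PowerSeries.X ^ 9
      - PowerSeries.C (17694848 / 1838453203125 : ℚ) * PowerSeries.X ^ 6
      - PowerSeries.C (330698309 / 81709031250 : ℚ) * PowerSeries.X ^ 3
      + PowerSeries.C (61927956 / 3242421875 : ℚ)
      + PowerSeries.C (48238574611 / 453939062500 : ℚ) * D
      - PowerSeries.C (1400615705869 / 453939062500 : ℚ) * D ^ 2
      + PowerSeries.C (1407265401 / 2316015625 : ℚ) * D ^ 3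
      + PowerSeries.C (59441369643 / 1875781250 : ℚ) * D ^ 4
      - PowerSeries.C (1024460784 / 19140625 : ℚ) * D ^ 5
      + PowerSeries.C (1889568 / 78125 : ℚ) * D ^ 6) ∧
    -- the generating function `A₅`
    (genFun 2 =
      PowerSeries.C (131072 / 197791083984375 : ℚ) * PowerSeries.X ^ 14
      + PowerSeries.C (90116032 / 564070869140625 : ℚ) * PowerSeries.X ^ 11
      - PowerSeries.C (324630499328 / 23302394349609375 : ℚ) * PowerSeries.X ^ 8
      + PowerSeries.C (4366976622 / 9785166015625 : ℚ) * PowerSeries.X ^ 5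
      - PowerSeries.C (385406999424 / 68496162109375 : ℚ) * PowerSeries.X ^ 2
      + PowerSeries.C (4531503785253 / 479473134765625 : ℚ) * PowerSeries.X ^ 2 * D
      + PowerSeries.C (59545228803909 / 479473134765625 : ℚ) * PowerSeries.X ^ 2 * D ^ 2
      - PowerSeries.C (37276082380518 / 13699232421875 : ℚ) * PowerSeries.X ^ 2 * D ^ 3
      + PowerSeries.C (14383449268992 / 2837119140625 : ℚ) * PowerSeries.X ^ 2 * D ^ 4
      + PowerSeries.C (268395996744 / 23447265625 : ℚ) * PowerSeries.X ^ 2 * D ^ 5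
      - PowerSeries.C (13329012672 / 478515625 : ℚ) * PowerSeries.X ^ 2 * D ^ 6
      + PowerSeries.C (136048896 / 9765625 : ℚ) * PowerSeries.X ^ 2 * D ^ 7) := by
  refine ⟨⟨?_, ?_, fun k hk => ?_⟩, ⟨?_, ?_, ?_, fun k hk => ?_⟩, ⟨?_, ?_, ?_, fun k hk => ?_⟩,
    genFun_one_eq.trans closedForm_three, genFun_zero_eq.trans closedForm_four,
    genFun_two_eq.trans closedForm_five⟩
  · exact (p_three_mul_add_one 1).trans (by norm_num)
  · exact (p_three_mul_add_one 2).trans (by norm_num)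
  · rw [p_three_mul_add_one, if_neg (by omega), if_neg (by omega), if_neg (by omega)]
    ring
  · exact (p_three_mul 2).trans (by norm_num)
  · exact (p_three_mul 3).trans (by norm_num)
  · exact (p_three_mul 4).trans (by norm_num)
  · rw [p_three_mul, if_neg (by omega), if_neg (by omega), if_neg (by omega), if_neg (by omega),
      if_neg (by omega)]
    ring
  · exact (p_three_mul_add_two 2).trans (by norm_num)
  · exact (p_three_mul_add_two 3).trans (by norm_num)
  · exact (p_three_mul_add_two 4).trans (by norm_num)
  · rw [p_three_mul_add_two, if_neg (by omega), if_neg (by omega), if_neg (by omega),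
      if_neg (by omega), if_neg (by omega)]
    ring
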